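/- **Setting.** Let $\Pi$ be a finite nonempty decision space (with all subsets measurable), let rewards lie in $\mathcal R=[0,1]$ and let $\mathcal O$ be any measurable space of observations. A model is a probability kernel $M:\Pi\to\Delta([0,1]\times\mathcal O)$. Write $f^M(\pi)=\mathbb E_{(r,o)\sim M(\pi)}[r]$ and $f^M(\pi_M)=\max_{\pi}f^M(\pi)$. Let $\mathcal M$ be a nonempty class of models and $\mathrm{co}(\mathcal M)$ the set of finite mixtures of its elements. An algorithm for horizon $T$ is a sequence $p^1,\dots,p^T$, where $p^t$ is a probability kernel from histories $(\pi^s,r^s,o^s)_{s<t}$ to $\Pi$. In round $t$, $\pi^t\sim p^t$, the adversary selects $M^t\in\mathcal M$, and $(r^t,o^t)\sim M^t(\pi^t)$ is revealed. An oblivious adversary draws the whole sequence $(M^1,\dots,M^T)$ independently of the interaction. The regret is $$\mathrm{Reg}=\sup_{\pi^\star\in\Pi}\sum_{t=1}^T\mathbb E_{\pi\sim p^t}\big[f^{M^t}(\pi^\star)-f^{M^t}(\pi)\big].$$ With $D_H^2(P,Q)=\int(\sqrt{dP}-\sqrt{dQ})^2$, for a class of models $\mathcal N$, a model $\bar M$,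 $\gamma>0$ and $\varepsilon\ge 0$ define $$\mathrm{dec}_\gamma(\mathcal N,\bar M)=\inf_{p\in\Delta(\Pi)}\sup_{M\in\mathcal N}\mathbb E_{\pi\sim p}\big[f^M(\pi_M)-f^M(\pi)-\gamma D_H^2(M(\pi),\bar M(\pi))\big],$$ $$\mathcal N_\varepsilon(\bar M)=\{M\in\mathcal N: f^{\bar M}(\pi_{\bar M})\ge f^M(\pi_M)-\varepsilon\},\qquad \mathrm{dec}_{\gamma,\varepsilon}(\mathcal N)=\sup_{\bar M\in\mathcal N}\mathrm{dec}_\gamma(\mathcal N_\varepsilon(\bar M),\bar M).$$ Further let $V(\mathcal M)=\max\big\{e,\ \sup_{M,M'\in\mathcal M}\sup_{\pi}\sup_{A\text{ measurable}}M(A\mid\pi)/M'(A\mid\pi)\big\}\in[e,\infty]$, and for $c>0$ set $C(T)=c\log(T\wedge V(\mathcal M))$ and $\varepsilon_\gamma=\gamma/(4C(T)T)$. **Theorem (main lower bound and its variant).** There are universal constants $c_0,a,b>0$ such that for every $c\ge c_0$, every $\Pi,\mathcal O,\mathcal M$ as above, every $T\ge 2$ and every algorithm for horizon $T$: 1. there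 is an oblivious adversary, drawing $M^1,\dots,M^T$ i.i.d. from a finitely supported distribution on $\mathcal M$, for which $$\mathbb E[\mathrm{Reg}]+\sqrt{\mathbb E\big[(\mathrm{Reg})_+^2\big]}\ \ge\ a\cdot\sup_{\gamma>\sqrt{2C(T)T}}\mathrm{dec}_{\gamma,\varepsilon_\gamma}(\mathrm{co}(\mathcal M))\cdot T-b\sqrt T;$$ 2. there is an oblivious adversary, drawing $M^1,\dots,M^T$ i.i.d. from a finitely supported distribution on $\mathcal M$, for which $\mathbb E[\mathrm{Reg}]\ge 0$ and $$\mathbb E[\mathrm{Reg}]+\sqrt{\mathbb E[\mathrm{Reg}]\cdot T}\ \ge\ a\cdot\sup_{\gamma>\sqrt{2C(T)T}}\mathrm{dec}_{\gamma,\varepsilon_\gamma}(\mathrm{co}(\mathcal M))\cdot T.$$ -/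

import Mathlib

open MeasureTheory ProbabilityTheory
open scoped ENNReal NNReal

namespace DMSO

/-- What the learner sees at one round once the decision is made: a reward in `[0,1]` and an
observation. -/
abbrev Feedback (O : Type*) := unitInterval × O

/-- One round of the interaction: decision, reward, observation. -/
abbrev Round (D O : Type*) := D × Feedback O

/-- A model: a probability kernel from decisions to (reward, observation) pairs. -/
structure Model (D O : Type*) [MeasurableSpace D] [MeasurableSpace O] where
  kernel : Kernel D (Feedback O)
  isMarkov : IsMarkovKernel kernel

/-- An algorithm for horizon `T`: for each round `t`, a probability kernel from the history of the
previous rounds to decisions (rounds are numbered from `0`, so round `t` has `t` predecessors). -/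
structure Algorithm (T : ℕ) (D O : Type*) [MeasurableSpace D] [MeasurableSpace O] where
  kernel : (t : ℕ) → t < T → Kernel (Fin t → Round D O) D
  isMarkov : ∀ t ht, IsMarkovKernel (kernel t ht)

section Definitions

variable {D O : Type*} [MeasurableSpace D] [MeasurableSpace O]

instance (M : Model D O) : IsMarkovKernel M.kernel := M.isMarkov

instance {T : ℕ} (alg : Algorithm T D O) (t : ℕ) (ht : t < T) :
    IsMarkovKernel (alg.kernel t ht) :=
  alg.isMarkov t ht

/-- The mean reward function `f^M(π) = E_{(r,o) ∼ M(π)}[r]`. -/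
noncomputable def Model.mean (M : Model D O) (π : D) : ℝ :=
  ∫ z, (z.1 : ℝ) ∂(M.kernel π)

/-- The optimal mean reward `f^M(π_M) = max_π f^M(π)` (used for finite nonempty `D`). -/
noncomputable def Model.opt (M : Model D O) : ℝ :=
  ⨆ π : D, M.mean π

/-- Squared Hellinger distance `∫ (√(dP/dν) - √(dQ/dν))² dν`, with the common dominating measure
`ν = P + Q`. -/
noncomputable def hellingerSq {Z : Type*} [MeasurableSpace Z] (P Q : Measure Z) : ℝ :=
  ∫ z, (√(P.rnDeriv (P + Q) z).toReal - √(Q.rnDeriv (P + Q) z).toReal) ^ 2 ∂(P + Q)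

/-- The convex hull of a model class: all finite mixtures of its models. -/
def co (𝓜 : Set (Model D O)) : Set (Model D O) :=
  {M | ∃ (n : ℕ) (w : Fin n → ℝ≥0) (m : Fin n → Model D O),
    (∑ i, w i = 1) ∧ (∀ i, m i ∈ 𝓜) ∧ ∀ π, M.kernel π = ∑ i, w i • (m i).kernel π}

/-- The Decision-Estimation Coefficient
`inf_{p ∈ Δ(D)} sup_{M ∈ 𝓜} E_{π ∼ p}[f^M(π_M) - f^M(π) - γ D_H²(M(π), Mbar(π))]`. -/
noncomputable def dec (γ : ℝ) (𝓜 : Set (Model D O)) (Mbar : Model D O) : ℝ :=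
  ⨅ p : ProbabilityMeasure D, ⨆ M : 𝓜,
    ∫ π, (M.1.opt - M.1.mean π - γ * hellingerSq (M.1.kernel π) (Mbar.kernel π))
      ∂(p : Measure D)

/-- The localized class `{M ∈ 𝓜 : f^Mbar(π_Mbar) ≥ f^M(π_M) - ε}`. -/
def localize (ε : ℝ) (𝓜 : Set (Model D O)) (Mbar : Model D O) : Set (Model D O) :=
  {M ∈ 𝓜 | Mbar.opt ≥ M.opt - ε}

/-- The localized Decision-Estimation Coefficient `dec_{γ,ε}(𝓜)`. -/
noncomputable def decLoc (γ ε : ℝ) (𝓜 : Set (Model D O)) : ℝ :=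
  ⨆ Mbar : 𝓜, dec γ (localize ε 𝓜 Mbar.1) Mbar.1

/-- The density-ratio bound `V(𝓜)`, the maximum of `e` and
`sup_{M, M' ∈ 𝓜} sup_π sup_A M(A ∣ π) / M'(A ∣ π)`, a possibly infinite number
(in `ℝ≥0∞`, `x / 0 = ∞` for `x ≠ 0`, and `0 / 0 = 0` does not affect the supremum). -/
noncomputable def densityRatio (𝓜 : Set (Model D O)) : ℝ≥0∞ :=
  (⨆ (M ∈ 𝓜) (M' ∈ 𝓜) (π : D) (A : Set (Feedback O)) (_ : MeasurableSet A),
    M.kernel π A / M'.kernel π A) ⊔ ENNReal.ofReal (Real.exp 1)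

/-- `C(T) = c · log (T ∧ V(𝓜))`. -/
noncomputable def logFactor (c : ℝ) (T : ℕ) (𝓜 : Set (Model D O)) : ℝ :=
  c * Real.log (min (T : ℝ≥0∞) (densityRatio 𝓜)).toReal

/-- The localization radius `ε_γ = γ / (4 C(T) T)`. -/
noncomputable def radius (c : ℝ) (T : ℕ) (𝓜 : Set (Model D O)) (γ : ℝ) : ℝ :=
  γ / (4 * logFactor c T 𝓜 * T)

/-- `sup_{γ > √(2 C(T) T)} dec_{γ, ε_γ}(co(𝓜))`. -/
noncomputable def lowerRate (c : ℝ) (T : ℕ) (𝓜 : Set (Model D O)) : ℝ :=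
  ⨆ γ : Set.Ioi (√(2 * logFactor c T 𝓜 * T)), decLoc γ.1 (radius c T 𝓜 γ.1) (co 𝓜)

variable {T : ℕ}

/-- The conditional law of round `t` given the past: `π ∼ p^t(· ∣ history)`, then
`(r, o) ∼ M^t(π)`. -/
noncomputable def roundKernel (alg : Algorithm T D O) (M : Fin T → Model D O) (t : ℕ)
    (ht : t < T) : Kernel (Fin t → Round D O) (Round D O) :=
  alg.kernel t ht ⊗ₖ Kernel.prodMkLeft (Fin t → Round D O) (M ⟨t, ht⟩).kernel

/-- The law of the first `t` rounds when the algorithm faces the sequence of models `M`. -/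
noncomputable def historyLaw (alg : Algorithm T D O) (M : Fin T → Model D O) :
    (t : ℕ) → t ≤ T → Measure (Fin t → Round D O)
  | 0, _ => Measure.dirac Fin.elim0
  | t + 1, ht =>
    (historyLaw alg M t (Nat.le_of_succ_le ht) ⊗ₘ roundKernel alg M t ht).map
      (fun q => Fin.snoc (α := fun _ => Round D O) q.1 q.2)

/-- The regret `sup_{π⋆} ∑_t E_{π ∼ p^t}[f^{M^t}(π⋆) - f^{M^t}(π)]` on the model sequence `M` and
the history `h`, where `p^t` is evaluated at the rounds before `t` (used for finite nonempty
`D`). -/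
noncomputable def regret (alg : Algorithm T D O) (M : Fin T → Model D O)
    (h : Fin T → Round D O) : ℝ :=
  ⨆ πs : D, ∑ t : Fin T,
    ∫ π, ((M t).mean πs - (M t).mean π)
      ∂(alg.kernel t t.2 (fun i : Fin (t : ℕ) => h (i.castLE t.2.le)))

/-- An oblivious adversary over `𝓜` (with finitely many candidate models): a law for the index
sequence of the models `M^1, …, M^T`, which does not depend on the interaction. -/
structure ObliviousAdversary (T : ℕ) (𝓜 : Set (Model D O)) where
  n : ℕ
  model : Fin n → Model D O
  mem : ∀ i, model i ∈ 𝓜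
  law : Measure (Fin T → Fin n)
  isProb : IsProbabilityMeasure law

namespace ObliviousAdversary

variable {𝓜 : Set (Model D O)}

/-- The adversary draws `M^1, …, M^T` independently from one (finitely supported) distribution
on `𝓜`. -/
def IsIID (adv : ObliviousAdversary T 𝓜) : Prop :=
  ∃ μ : Measure (Fin adv.n), IsProbabilityMeasure μ ∧ adv.law = Measure.pi (fun _ => μ)

/-- The joint law of the index sequence of the models and the history of the interaction: the
sequence is drawn first, then the algorithm interacts with it. -/
noncomputable def jointLaw (adv : ObliviousAdversary T 𝓜) (alg : Algorithm T D O) :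
    Measure ((Fin T → Fin adv.n) × (Fin T → Round D O)) :=
  adv.law ⊗ₘ Kernel.ofFunOfCountable
    (fun s => historyLaw alg (fun t => adv.model (s t)) T le_rfl)

/-- `E[φ(Reg)]` under the joint law of models and history. -/
noncomputable def expectRegret (adv : ObliviousAdversary T 𝓜) (alg : Algorithm T D O)
    (φ : ℝ → ℝ) : ℝ :=
  ∫ ω, φ (regret alg (fun t => adv.model (ω.1 t)) ω.2) ∂(adv.jointLaw alg)

end ObliviousAdversary

end Definitions

end DMSO

/-! Fix the algorithm, a level `r ≥ 0` below the localized coefficient, and a reference `P` in `co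
𝓜` witnessing it. Test the infimum over decision laws at the law of the decision in a uniformly
random round of play against `P`. This yields `Q`, with optimum at most `ε` above that of `P`, whose
average gap `X_Q` has mean at least `r + γ E` under `P`, where `E` is the average one-round squared
Hellinger distance. It remains to see that the algorithm does badly under `P` or under `Q`: `r ≤ 5
‖X_P‖ + 5 ‖X_Q‖`, each norm being L² under the model's own history law.

Two comparisons give this. Locally, `X_Q ≤ X_P + ε + 2 F` with `F` the average of the one-round
Hellinger distances, which bounds the second moment of `X_Q` under `P`. Globally,
`integral_historyLaw_le` moves the mean of `X_Q` from `P` to `Q` at a cost of order `√(T E)` times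
root second moments. Its proof discounts the Hellinger integrand of the two histories by `exp (-2 ·
accumulated distance)`, so only an expectation under `P` enters and no logarithm of a density ratio
appears. If `T E ≥ 1` the local comparison suffices; if `T E ≤ 1` the factor `√(T E)` tames the
second moment (`lower_bound_arith`). All that is needed of `C(T)` is `C(T) ≥ 128`.

Finally, drawing the models i.i.d. from the mixture representing the bad model produces the history
law of that mixture (`lintegral_indexedLaw`). The regret against its best decision is `T` times the
average gap plus a centered sum with orthogonal increments, of second moment at most `4 T`. The L²
bound gives the first claim with an error of order `√T`; as the average gap lies in `[0,1]`, its
second moment is at most its mean, which gives the second claim. One adversary serves both. -/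

namespace DMSO

/-! ### Hellinger distance: densities against the mixture, comparison of means. -/

section Hellinger

variable {Z : Type*} [MeasurableSpace Z]

lemma hellingerSq_nonneg (P Q : Measure Z) : 0 ≤ hellingerSq P Q :=
  integral_nonneg fun _ => sq_nonneg _

lemma hellingerSq_comm (P Q : Measure Z) : hellingerSq P Q = hellingerSq Q P := by
  unfold hellingerSq
  rw [add_comm Q P]
  congr 1
  ext z
  ring

/-- The equal-weight mixture of two measures. -/
noncomputable def midMeasure (P Q : Measure Z) : Measure Z := (2⁻¹ : ℝ≥0∞) • (P + Q)

instance (P Q : Measure Z) [IsProbabilityMeasure P] [IsProbabilityMeasure Q] :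
    IsProbabilityMeasure (midMeasure P Q) := by
  refine ⟨?_⟩
  simp only [midMeasure, Measure.smul_apply, Measure.add_apply, measure_univ, smul_eq_mul]
  rw [one_add_one_eq_two]
  exact ENNReal.inv_mul_cancel (by norm_num) (by norm_num)

/-- Two probability measures have densities `p` and `2 - p` with respect to their mixture. -/
lemma exists_density (P Q : Measure Z) [IsProbabilityMeasure P] [IsProbabilityMeasure Q] :
    ∃ p : Z → ℝ, Measurable p ∧ (∀ z, 0 ≤ p z) ∧ (∀ z, p z ≤ 2) ∧
      P = (midMeasure P Q).withDensity (fun z => ENNReal.ofReal (p z)) ∧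
      Q = (midMeasure P Q).withDensity (fun z => ENNReal.ofReal (2 - p z)) ∧
      hellingerSq P Q = ∫ z, (√(p z) - √(2 - p z)) ^ 2 ∂(midMeasure P Q) := by
  set ν := P + Q with hν
  have hPν : P ≪ ν := Measure.absolutelyContinuous_of_le (Measure.le_add_right le_rfl)
  have hQν : Q ≪ ν := Measure.absolutelyContinuous_of_le (Measure.le_add_left le_rfl)
  have hsum : ∀ᵐ z ∂ν, P.rnDeriv ν z + Q.rnDeriv ν z = 1 := by
    filter_upwards [Measure.rnDeriv_add P Q ν, Measure.rnDeriv_self ν] with z h1 h2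
    rw [← Pi.add_apply, ← h1, ← hν, h2]
  -- The two derivatives sum to 1 almost everywhere; capping makes the bounds hold at every point.
  -- The later factor 2 passes from `P + Q` to the probability measure `midMeasure P Q`.
  let u : Z → ℝ := fun z => min (P.rnDeriv ν z).toReal 1
  have hu : Measurable u := ((Measure.measurable_rnDeriv P ν).ennreal_toReal).min measurable_const
  have hu0 : ∀ z, 0 ≤ u z := fun z => le_min ENNReal.toReal_nonneg zero_le_one
  have hu1 : ∀ z, u z ≤ 1 := fun z => min_le_right _ _
  have hPu : ∀ᵐ z ∂ν, P.rnDeriv ν z = ENNReal.ofReal (u z) := by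
    filter_upwards [hsum] with z hz
    have h1 : P.rnDeriv ν z ≤ 1 := by rw [← hz]; exact le_self_add
    have h2 : (P.rnDeriv ν z).toReal ≤ 1 := by
      simpa using ENNReal.toReal_mono ENNReal.one_ne_top h1
    simp only [u, min_eq_left h2]
    rw [ENNReal.ofReal_toReal (ne_top_of_le_ne_top ENNReal.one_ne_top h1)]
  have hQu : ∀ᵐ z ∂ν, Q.rnDeriv ν z = ENNReal.ofReal (1 - u z) := by
    filter_upwards [hsum, hPu] with z hz h1
    rw [ENNReal.ofReal_sub _ (hu0 z), ENNReal.ofReal_one, ← h1]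
    refine ENNReal.eq_sub_of_add_eq ?_ (by rw [add_comm]; exact hz)
    rw [h1]; exact ENNReal.ofReal_ne_top
  have hdens : ∀ f : Z → ℝ, Measurable f →
      (midMeasure P Q).withDensity (fun z => ENNReal.ofReal (2 * f z)) =
        ν.withDensity (fun z => ENNReal.ofReal (f z)) := by
    intro f hf
    rw [midMeasure, withDensity_smul_measure, ← withDensity_smul _ (by fun_prop)]
    congr 1
    ext z
    simp only [Pi.smul_apply, smul_eq_mul]
    rw [ENNReal.ofReal_mul zero_le_two, ← mul_assoc, ENNReal.ofReal_ofNat,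
      ENNReal.inv_mul_cancel (by norm_num) (by norm_num), one_mul]
  refine ⟨fun z => 2 * u z, by fun_prop, fun z => by linarith [hu0 z], fun z => by linarith [hu1 z],
    ?_, ?_, ?_⟩
  · rw [hdens u hu, ← withDensity_congr_ae hPu, Measure.withDensity_rnDeriv_eq _ _ hPν]
  · have : (fun z => ENNReal.ofReal (2 - 2 * u z)) = fun z => ENNReal.ofReal (2 * (1 - u z)) := by
      ext z; congr 1; ring
    rw [this, hdens (fun z => 1 - u z) (by fun_prop), ← withDensity_congr_ae hQu,
      Measure.withDensity_rnDeriv_eq _ _ hQν]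
  · rw [midMeasure, integral_smul_measure, hellingerSq, ← hν, ← integral_smul]
    refine integral_congr_ae ?_
    filter_upwards [hPu, hQu] with z h1 h2
    rw [h1, h2, ENNReal.toReal_ofReal (hu0 z), ENNReal.toReal_ofReal (by linarith [hu1 z]),
      show (2 : ℝ) - 2 * u z = 2 * (1 - u z) by ring, Real.sqrt_mul zero_le_two,
      Real.sqrt_mul zero_le_two, ← mul_sub, mul_pow, Real.sq_sqrt zero_le_two]
    simp

lemma integral_withDensity_ofReal (μ : Measure Z) {p : Z → ℝ} (hp : Measurable p)
    (hp0 : ∀ z, 0 ≤ p z) (f : Z → ℝ) :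
    ∫ z, f z ∂(μ.withDensity fun z => ENNReal.ofReal (p z)) = ∫ z, p z * f z ∂μ := by
  rw [integral_withDensity_eq_integral_toReal_smul (by fun_prop) (by simp)]
  simp [ENNReal.toReal_ofReal (hp0 _)]

lemma integrable_of_abs_le {μ : Measure Z} [IsFiniteMeasure μ] {f : Z → ℝ} (hf : Measurable f)
    {C : ℝ} (hC : ∀ z, |f z| ≤ C) : Integrable f μ :=
  Integrable.of_bound hf.aestronglyMeasurable C (ae_of_all _ hC)

/-- The Cauchy-Schwarz inequality for integrals of bounded measurable functions. -/
lemma abs_integral_mul_le {μ : Measure Z} [IsFiniteMeasure μ] {f g : Z → ℝ} (hf : Measurable f)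
    (hg : Measurable g) {C : ℝ} (hfC : ∀ z, |f z| ≤ C) (hgC : ∀ z, |g z| ≤ C) :
    |∫ z, f z * g z ∂μ| ≤ √(∫ z, f z ^ 2 ∂μ) * √(∫ z, g z ^ 2 ∂μ) := by
  have hC : ∀ {u v : Z → ℝ}, (∀ z, |u z| ≤ C) → (∀ z, |v z| ≤ C) → ∀ z, |u z * v z| ≤ C * C :=
    fun hu hv z => by
      rw [abs_mul]
      exact mul_le_mul (hu z) (hv z) (abs_nonneg _) ((abs_nonneg _).trans (hu z))
  have hff : Integrable (fun z => f z ^ 2) μ := by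
    simp_rw [sq]; exact integrable_of_abs_le (hf.mul hf) (hC hfC hfC)
  have hgg : Integrable (fun z => g z ^ 2) μ := by
    simp_rw [sq]; exact integrable_of_abs_le (hg.mul hg) (hC hgC hgC)
  have hfg : Integrable (fun z => f z * g z) μ := integrable_of_abs_le (hf.mul hg) (hC hfC hgC)
  rw [← Real.sqrt_mul (integral_nonneg fun _ => sq_nonneg _)]
  refine Real.abs_le_sqrt ?_
  have key : ∀ t : ℝ, 0 ≤ (∫ z, g z ^ 2 ∂μ) * (t * t) + (-2 * ∫ z, f z * g z ∂μ) * t +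
      ∫ z, f z ^ 2 ∂μ := by
    intro t
    have h : ∫ z, (f z - t * g z) ^ 2 ∂μ = (∫ z, g z ^ 2 ∂μ) * (t * t) +
        (-2 * ∫ z, f z * g z ∂μ) * t + ∫ z, f z ^ 2 ∂μ := by
      have : (fun z => (f z - t * g z) ^ 2) =
          fun z => (t * t) * g z ^ 2 + (-2 * t) * (f z * g z) + f z ^ 2 := by ext z; ring
      have hi : Integrable (fun z => (t * t) * g z ^ 2 + (-2 * t) * (f z * g z)) μ :=
        (hgg.const_mul _).add (hfg.const_mul _)
      rw [this, integral_add hi hff, integral_add (hgg.const_mul _) (hfg.const_mul _), integral_const_mul, integral_const_mul]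
      ring
    rw [← h]
    exact integral_nonneg fun _ => sq_nonneg _
  have := discrim_le_zero key
  unfold discrim at this
  nlinarith

/-- The squared Hellinger distance controls differences of means. -/
lemma integral_sub_integral_le (P Q : Measure Z) [IsProbabilityMeasure P] [IsProbabilityMeasure Q]
    {f : Z → ℝ} (hf : Measurable f) (hf1 : ∀ z, |f z| ≤ 1) :
    ∫ z, f z ∂P - ∫ z, f z ∂Q ≤ 2 * √(hellingerSq P Q) := by
  obtain ⟨p, hp, hp0, hp2, hP, hQ, hH⟩ := exists_density P Q
  set N := midMeasure P Q
  have hs : ∀ x : ℝ, 0 ≤ x → x ≤ 2 → √x ≤ 2 := fun x h0 h2 =>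
    (Real.sqrt_le_left zero_le_two).mpr (by linarith)
  have hi : ∀ r : Z → ℝ, Measurable r → (∀ z, 0 ≤ r z) → (∀ z, r z ≤ 2) →
      Integrable (fun z => r z * f z) N := fun r hr h0 h2 =>
    integrable_of_abs_le (C := 2) (hr.mul hf) fun z => by
      rw [abs_mul, abs_of_nonneg (h0 z)]
      nlinarith [h0 z, h2 z, hf1 z, abs_nonneg (f z)]
  -- The difference of densities is a difference of squares of roots, which isolates the Hellinger
  -- integrand. The other factor has L² norm at most 2, because `(√p + √(2 - p))² ≤ 4`.
  have e : ∫ z, f z ∂P - ∫ z, f z ∂Q =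
      ∫ z, (√(p z) - √(2 - p z)) * (f z * (√(p z) + √(2 - p z))) ∂N := by
    have h1 : ∫ z, f z ∂P = ∫ z, p z * f z ∂N := by
      conv_lhs => rw [hP]
      exact integral_withDensity_ofReal N hp hp0 f
    have h2 : ∫ z, f z ∂Q = ∫ z, (2 - p z) * f z ∂N := by
      conv_lhs => rw [hQ]
      exact integral_withDensity_ofReal N (by fun_prop) (fun z => by linarith [hp2 z]) f
    rw [h1, h2, ← integral_sub (hi p hp hp0 hp2) (hi (fun z => 2 - p z) (by fun_prop)
      (fun z => by linarith [hp2 z]) (fun z => by linarith [hp0 z]))]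
    congr 1
    ext z
    have a := Real.sq_sqrt (hp0 z)
    have b := Real.sq_sqrt (show 0 ≤ 2 - p z by linarith [hp2 z])
    linear_combination (-f z) * a + f z * b
  have ha : ∀ z, 0 ≤ √(p z) ∧ √(p z) ≤ 2 ∧ 0 ≤ √(2 - p z) ∧ √(2 - p z) ≤ 2 := fun z =>
    ⟨Real.sqrt_nonneg _, hs _ (hp0 z) (hp2 z), Real.sqrt_nonneg _,
      hs _ (by linarith [hp2 z]) (by linarith [hp0 z])⟩
  have hcs := abs_integral_mul_le (μ := N) (f := fun z => √(p z) - √(2 - p z))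
    (g := fun z => f z * (√(p z) + √(2 - p z))) (by fun_prop) (by fun_prop) (C := 4)
    (fun z => by obtain ⟨h1, h2, h3, h4⟩ := ha z; rw [abs_le]; constructor <;> linarith)
    (fun z => by
      obtain ⟨h1, h2, h3, h4⟩ := ha z
      rw [abs_mul, abs_of_nonneg (add_nonneg h1 h3)]
      nlinarith [hf1 z, abs_nonneg (f z)])
  rw [e]
  refine (le_abs_self _).trans (hcs.trans ?_)
  rw [← hH, mul_comm]
  refine mul_le_mul_of_nonneg_right ?_ (Real.sqrt_nonneg _)
  refine (Real.sqrt_le_left zero_le_two).mpr ?_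
  calc ∫ z, (f z * (√(p z) + √(2 - p z))) ^ 2 ∂N ≤ ∫ _, (4 : ℝ) ∂N := by
        refine integral_mono_of_nonneg (ae_of_all _ fun _ => sq_nonneg _) (integrable_const _)
          (ae_of_all _ fun z => ?_)
        have a := Real.sq_sqrt (hp0 z)
        have b := Real.sq_sqrt (show 0 ≤ 2 - p z by linarith [hp2 z])
        have h1 : f z ^ 2 ≤ 1 := by rw [sq_le_one_iff_abs_le_one]; exact hf1 z
        have h2 : (√(p z) + √(2 - p z)) ^ 2 ≤ 4 := by
          nlinarith [sq_nonneg (√(p z) - √(2 - p z))]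
        show (f z * (√(p z) + √(2 - p z))) ^ 2 ≤ 4
        rw [mul_pow]
        nlinarith [sq_nonneg (f z), sq_nonneg (√(p z) + √(2 - p z))]
    _ = 2 ^ 2 := by simp; norm_num

end Hellinger

/-! ### Laws of histories and cumulative conditional expectations. -/

section History

variable {D O : Type*} [MeasurableSpace D] [MeasurableSpace O] {T : ℕ}

lemma measurable_snoc (t : ℕ) {R : Type*} [MeasurableSpace R] :
    Measurable fun q : (Fin t → R) × R => Fin.snoc (α := fun _ => R) q.1 q.2 := by
  refine measurable_pi_iff.mpr fun i => ?_
  refine Fin.lastCases ?_ (fun i => ?_) i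
  · simpa using measurable_snd
  · simpa using measurable_pi_iff.mp measurable_fst i

instance (alg : Algorithm T D O) (M : Fin T → Model D O) (t : ℕ) (ht : t < T) :
    IsMarkovKernel (roundKernel alg M t ht) := by
  unfold roundKernel; infer_instance

lemma historyLaw_succ (alg : Algorithm T D O) (M : Fin T → Model D O) (t : ℕ) (ht : t + 1 ≤ T) :
    historyLaw alg M (t + 1) ht =
      (historyLaw alg M t (Nat.le_of_succ_le ht) ⊗ₘ roundKernel alg M t ht).map
        (fun q => Fin.snoc (α := fun _ => Round D O) q.1 q.2) := rfl

instance (alg : Algorithm T D O) (M : Fin T → Model D O) (t : ℕ) (ht : t ≤ T) :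
    IsProbabilityMeasure (historyLaw alg M t ht) := by
  induction t with
  | zero => unfold historyLaw; infer_instance
  | succ t ih =>
    have := ih (Nat.le_of_succ_le ht)
    rw [historyLaw_succ]
    exact Measure.isProbabilityMeasure_map (measurable_snoc t).aemeasurable

lemma lintegral_historyLaw_succ (alg : Algorithm T D O) (M : Fin T → Model D O) (t : ℕ)
    (ht : t + 1 ≤ T) {f : (Fin (t + 1) → Round D O) → ℝ≥0∞} (hf : Measurable f) :
    ∫⁻ h, f h ∂historyLaw alg M (t + 1) ht =
      ∫⁻ h, ∫⁻ π, ∫⁻ z, f (Fin.snoc (α := fun _ => Round D O) h (π, z))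
        ∂(M ⟨t, ht⟩).kernel π ∂alg.kernel t ht h ∂historyLaw alg M t (Nat.le_of_succ_le ht) := by
  have hs := measurable_snoc t (R := Round D O)
  have hfs : Measurable fun q : (Fin t → Round D O) × Round D O =>
      f (Fin.snoc (α := fun _ => Round D O) q.1 q.2) := hf.comp hs
  rw [historyLaw_succ, lintegral_map hf hs, Measure.lintegral_compProd hfs]
  refine lintegral_congr fun h => ?_
  rw [roundKernel, Kernel.lintegral_compProd _ _ _ (by
    exact hf.comp (hs.comp (measurable_const.prodMk measurable_id)))]
  simp [Kernel.prodMkLeft_apply]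

lemma integral_historyLaw_succ (alg : Algorithm T D O) (M : Fin T → Model D O) (t : ℕ)
    (ht : t + 1 ≤ T) {f : (Fin (t + 1) → Round D O) → ℝ} (hf : Measurable f) {C : ℝ}
    (hC : ∀ h, |f h| ≤ C) :
    ∫ h, f h ∂historyLaw alg M (t + 1) ht =
      ∫ h, ∫ π, ∫ z, f (Fin.snoc (α := fun _ => Round D O) h (π, z))
        ∂(M ⟨t, ht⟩).kernel π ∂alg.kernel t ht h ∂historyLaw alg M t (Nat.le_of_succ_le ht) := by
  have hs := measurable_snoc t (R := Round D O)
  have hfs : Measurable fun q : (Fin t → Round D O) × Round D O =>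
      f (Fin.snoc (α := fun _ => Round D O) q.1 q.2) := hf.comp hs
  rw [historyLaw_succ, integral_map hs.aemeasurable hf.aestronglyMeasurable,
    Measure.integral_compProd (integrable_of_abs_le hfs fun _ => hC _)]
  refine integral_congr_ae (ae_of_all _ fun h => ?_)
  have h1 : Measurable fun x : Round D O => f (Fin.snoc (α := fun _ => Round D O) h x) :=
    hf.comp (hs.comp (measurable_const.prodMk measurable_id))
  show ∫ x, f (Fin.snoc (α := fun _ => Round D O) h x) ∂roundKernel alg M t ht h = _
  rw [roundKernel, ProbabilityTheory.integral_compProd]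
  · simp [Kernel.prodMkLeft_apply]
  · exact integrable_of_abs_le h1 fun _ => hC _

/-- The sum over the first `t` rounds of the conditional expectations of `φ s π^s`. -/
noncomputable def cum (alg : Algorithm T D O) (φ : Fin T → D → ℝ) (t : ℕ) (ht : t ≤ T)
    (h : Fin t → Round D O) : ℝ :=
  ∑ s : Fin t, ∫ π, φ (s.castLE ht) π
    ∂(alg.kernel s (s.2.trans_le ht) fun i : Fin (s : ℕ) => h (i.castLE s.2.le))

lemma cum_zero (alg : Algorithm T D O) (φ : Fin T → D → ℝ) (ht : 0 ≤ T)
    (h : Fin 0 → Round D O) : cum alg φ 0 ht h = 0 := by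
  simp [cum]

lemma cum_succ (alg : Algorithm T D O) (φ : Fin T → D → ℝ) (t : ℕ) (ht : t + 1 ≤ T)
    (h : Fin t → Round D O) (x : Round D O) :
    cum alg φ (t + 1) ht (Fin.snoc (α := fun _ => Round D O) h x) =
      cum alg φ t (Nat.le_of_succ_le ht) h + ∫ π, φ ⟨t, ht⟩ π ∂alg.kernel t ht h := by
  -- Round `s` conditions only on the rounds before it, so appending `x` changes no earlier summand,
  -- and the new summand sees exactly `h`.
  have key : ∀ (s : ℕ) (hs : s ≤ t) (i : Fin s),
      Fin.snoc (α := fun _ => Round D O) h x (i.castLE (hs.trans t.le_succ)) = h (i.castLE hs) := by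
    intro s hs i
    have : i.castLE (hs.trans t.le_succ) = (i.castLE hs).castSucc := rfl
    rw [this, Fin.snoc_castSucc]
  unfold cum
  rw [Fin.sum_univ_castSucc]
  congr 1
  · refine Finset.sum_congr rfl fun s _ => ?_
    have : (fun i : Fin (s.castSucc : ℕ) => Fin.snoc (α := fun _ => Round D O) h x
        (i.castLE s.castSucc.2.le)) = fun i : Fin (s : ℕ) => h (i.castLE s.2.le) :=
      funext fun i => key s s.2.le i
    rw [this]
    rfl
  · have : (fun i : Fin (Fin.last t : ℕ) => Fin.snoc (α := fun _ => Round D O) h x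
        (i.castLE (Fin.last t).2.le)) = h := funext fun i => key t le_rfl i
    rw [this]
    rfl

lemma cum_const (alg : Algorithm T D O) (c : ℝ) (t : ℕ) (ht : t ≤ T)
    (x : Fin t → Round D O) : cum alg (fun _ _ => c) t ht x = t * c := by
  simp [cum]

lemma cum_const_mul (alg : Algorithm T D O) (c : ℝ) (φ : Fin T → D → ℝ) (t : ℕ)
    (ht : t ≤ T) (x : Fin t → Round D O) :
    cum alg (fun s π => c * φ s π) t ht x = c * cum alg φ t ht x := by
  simp only [cum, Finset.mul_sum]
  exact Finset.sum_congr rfl fun s _ => integral_const_mul _ _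

lemma exists_abs_le {ι D : Type*} [Finite ι] [Finite D] (φ : ι → D → ℝ) : ∃ K, ∀ s π, |φ s π| ≤ K := by
  obtain ⟨K, hK⟩ := (Set.finite_range fun x : ι × D => |φ x.1 x.2|).bddAbove
  exact ⟨K, fun s π => hK ⟨(s, π), rfl⟩⟩

variable [Finite D] [MeasurableSingletonClass D]

lemma integrable_of_finite (μ : Measure D) [IsFiniteMeasure μ] (f : D → ℝ) : Integrable f μ :=
  Integrable.of_finite

lemma measurable_cum (alg : Algorithm T D O) (φ : Fin T → D → ℝ) (t : ℕ) (ht : t ≤ T) :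
    Measurable (cum alg φ t ht) := by
  unfold cum
  refine Finset.measurable_sum _ fun s _ => ?_
  have h1 : StronglyMeasurable (φ (s.castLE ht)) :=
    (Measurable.of_discrete).stronglyMeasurable
  exact (h1.integral_kernel (κ := alg.kernel s (s.2.trans_le ht))).measurable.comp
    (measurable_pi_iff.mpr fun i => measurable_pi_apply _)

lemma cum_mono (alg : Algorithm T D O) {φ ψ : Fin T → D → ℝ} (h : ∀ s π, φ s π ≤ ψ s π) (t : ℕ)
    (ht : t ≤ T) (x : Fin t → Round D O) : cum alg φ t ht x ≤ cum alg ψ t ht x :=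
  Finset.sum_le_sum fun _ _ => integral_mono (integrable_of_finite _ _) (integrable_of_finite _ _)
    (h _)

lemma cum_add (alg : Algorithm T D O) (φ ψ : Fin T → D → ℝ) (t : ℕ)
    (ht : t ≤ T) (x : Fin t → Round D O) :
    cum alg (fun s π => φ s π + ψ s π) t ht x = cum alg φ t ht x + cum alg ψ t ht x := by
  simp only [cum, ← Finset.sum_add_distrib]
  exact Finset.sum_congr rfl fun s _ =>
    integral_add (integrable_of_finite _ _) (integrable_of_finite _ _)

lemma abs_cum_le (alg : Algorithm T D O) {φ : Fin T → D → ℝ} {K : ℝ} (h : ∀ s π, |φ s π| ≤ K)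
    (t : ℕ) (ht : t ≤ T) (x : Fin t → Round D O) : |cum alg φ t ht x| ≤ t * K := by
  rw [abs_le]
  constructor
  · rw [← mul_neg, ← cum_const alg (-K) t ht x]
    exact cum_mono alg (fun s π => (abs_le.mp (h s π)).1) t ht x
  · rw [← cum_const alg K t ht x]
    exact cum_mono alg (fun s π => (abs_le.mp (h s π)).2) t ht x

lemma cum_nonneg (alg : Algorithm T D O) {φ : Fin T → D → ℝ} (h : ∀ s π, 0 ≤ φ s π)
    (t : ℕ) (ht : t ≤ T) (x : Fin t → Round D O) : 0 ≤ cum alg φ t ht x := by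
  have := cum_mono alg (φ := fun _ _ => 0) h t ht x
  rwa [cum_const, mul_zero] at this

/-- Jensen's inequality for the average over the rounds. -/
lemma sq_cum_le (alg : Algorithm T D O) (φ : Fin T → D → ℝ) (t : ℕ) (ht : t ≤ T)
    (x : Fin t → Round D O) :
    cum alg φ t ht x ^ 2 ≤ t * cum alg (fun s π => φ s π ^ 2) t ht x := by
  -- Tangent-line form of Jensen, from `2 a φ - a² ≤ φ²`; the best `a` is the average `cum / t`.
  have h1 : ∀ a : ℝ, 2 * a * cum alg φ t ht x - t * a ^ 2 ≤
      cum alg (fun s π => φ s π ^ 2) t ht x := by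
    intro a
    have := cum_mono alg (φ := fun s π => (2 * a) * φ s π + (-a ^ 2))
      (ψ := fun s π => φ s π ^ 2) (fun s π => by nlinarith [sq_nonneg (φ s π - a)]) t ht x
    rw [cum_add, cum_const_mul, cum_const] at this
    linarith
  rcases Nat.eq_zero_or_pos t with rfl | htp
  · simp [cum_zero]
  have ht0 : (0 : ℝ) < t := Nat.cast_pos.mpr htp
  have := mul_le_mul_of_nonneg_left (h1 (cum alg φ t ht x / t)) ht0.le
  refine le_trans (le_of_eq ?_) this
  field_simp
  ring

end History

/-! ### Change of measure with a weighted Hellinger bound. -/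

/-- A change of measure from density `a ^ 2` to density `b ^ 2`, where the squared Hellinger
distance is only controlled after weighting with `g`. -/
lemma integral_sq_mul_le {Z : Type*} [MeasurableSpace Z] {ρ : Measure Z} [IsFiniteMeasure ρ]
    {a b g X : Z → ℝ} (ha : Measurable a) (hb : Measurable b) (hg : Measurable g)
    (hX : Measurable X) {C : ℝ} (ha0 : ∀ z, 0 ≤ a z) (hb0 : ∀ z, 0 ≤ b z) (hg0 : ∀ z, 0 ≤ g z)
    (hX0 : ∀ z, 0 ≤ X z) (haC : ∀ z, a z ≤ C) (hbC : ∀ z, b z ≤ C) (hg1 : ∀ z, g z ≤ 1)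
    (hX1 : ∀ z, X z ≤ 1) {β : ℝ} (h1 : ∫ z, (a z - b z) ^ 2 * g z ∂ρ ≤ β)
    (h2 : ∫ z, a z ^ 2 * (1 - g z) ∂ρ ≤ β) :
    ∫ z, a z ^ 2 * X z ∂ρ ≤ ∫ z, b z ^ 2 * X z ∂ρ + √β * (√(∫ z, a z ^ 2 * X z ^ 2 ∂ρ) +
      √(2 * (∫ z, a z ^ 2 * X z ^ 2 ∂ρ + ∫ z, b z ^ 2 * X z ^ 2 ∂ρ))) := by
  have hint : ∀ {u v : Z → ℝ}, Measurable u → Measurable v → (∀ z, 0 ≤ u z) → (∀ z, u z ≤ C) →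
      (∀ z, 0 ≤ v z) → (∀ z, v z ≤ 1) → Integrable (fun z => u z ^ 2 * v z) ρ := by
    intro u v hu hv hu0 huC hv0 hv1
    refine integrable_of_abs_le ((hu.pow_const 2).mul hv) (C := C ^ 2) fun z => ?_
    rw [abs_mul, abs_of_nonneg (sq_nonneg _), abs_of_nonneg (hv0 z)]
    exact (mul_le_of_le_one_right (sq_nonneg _) (hv1 z)).trans
      (pow_le_pow_left₀ (hu0 z) (huC z) 2)
  have hXX : ∀ z, X z ^ 2 ≤ 1 := fun z => pow_le_one₀ (hX0 z) (hX1 z)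
  have hsg0 : ∀ z, 0 ≤ √(g z) := fun z => Real.sqrt_nonneg _
  have hsg1 : ∀ z, √(g z) ≤ 1 := fun z => Real.sqrt_le_one.mpr (hg1 z)
  have iaX := hint ha hX ha0 haC hX0 hX1
  have ibX := hint hb hX hb0 hbC hX0 hX1
  have iaXX := hint ha (hX.pow_const 2) ha0 haC (fun z => sq_nonneg _) hXX
  have ibXX := hint hb (hX.pow_const 2) hb0 hbC (fun z => sq_nonneg _) hXX
  have key : ∀ {u v : Z → ℝ}, Measurable u → Measurable v → (∀ z, |u z| ≤ 2 * C) →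
      (∀ z, |v z| ≤ 2 * C) → Integrable (fun z => u z * v z) ρ := by
    intro u v hu hv h1 h2
    refine integrable_of_abs_le (hu.mul hv) (C := (2 * C) * (2 * C)) fun z => ?_
    rw [abs_mul]
    exact mul_le_mul (h1 z) (h2 z) (abs_nonneg _) ((abs_nonneg _).trans (h1 z))
  have b1 : ∀ z, |a z * X z| ≤ 2 * C := fun z => by
    rw [abs_of_nonneg (mul_nonneg (ha0 z) (hX0 z))]
    nlinarith [ha0 z, hX0 z, haC z, hX1 z]
  have b2 : ∀ z, |a z * (1 - g z)| ≤ 2 * C := fun z => by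
    rw [abs_of_nonneg (mul_nonneg (ha0 z) (by linarith [hg1 z]))]
    nlinarith [ha0 z, hg0 z, haC z, hg1 z]
  have b3 : ∀ z, |X z * √(g z) * (a z + b z)| ≤ 2 * C := fun z => by
    have h3 : X z * √(g z) ≤ 1 := mul_le_one₀ (hX1 z) (hsg0 z) (hsg1 z)
    have h4 := mul_nonneg (hX0 z) (hsg0 z)
    rw [abs_of_nonneg (mul_nonneg h4 (add_nonneg (ha0 z) (hb0 z)))]
    nlinarith [ha0 z, haC z, hb0 z, hbC z]
  have b4 : ∀ z, |√(g z) * (a z - b z)| ≤ 2 * C := fun z => by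
    rw [abs_mul, abs_of_nonneg (hsg0 z)]
    have h3 : |a z - b z| ≤ 2 * C := by
      rw [abs_le]; constructor <;> linarith [ha0 z, haC z, hb0 z, hbC z]
    nlinarith [hsg0 z, hsg1 z, abs_nonneg (a z - b z)]
  have m1 : Measurable fun z => a z * X z := ha.mul hX
  have m2 : Measurable fun z => a z * (1 - g z) := ha.mul (measurable_const.sub hg)
  have m3 : Measurable fun z => X z * √(g z) * (a z + b z) := by fun_prop
  have m4 : Measurable fun z => √(g z) * (a z - b z) := by fun_prop
  have c1 := (le_abs_self _).trans (abs_integral_mul_le (μ := ρ) m1 m2 b1 b2)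
  have c2 := (le_abs_self _).trans (abs_integral_mul_le (μ := ρ) m3 m4 b3 b4)
  have e1 : ∫ z, (a z * X z) ^ 2 ∂ρ = ∫ z, a z ^ 2 * X z ^ 2 ∂ρ := by simp_rw [mul_pow]
  have e2 : ∫ z, (a z * (1 - g z)) ^ 2 ∂ρ ≤ β := by
    refine le_trans (integral_mono_of_nonneg (ae_of_all _ fun _ => sq_nonneg _)
      (hint ha (measurable_const.sub hg) ha0 haC (fun z => sub_nonneg.mpr (hg1 z))
        (fun z => sub_le_self 1 (hg0 z))) (ae_of_all _ fun z => ?_)) h2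
    show (a z * (1 - g z)) ^ 2 ≤ a z ^ 2 * (1 - g z)
    rw [mul_pow]
    refine mul_le_mul_of_nonneg_left ?_ (sq_nonneg _)
    nlinarith [hg0 z, hg1 z]
  have e3 : ∫ z, (X z * √(g z) * (a z + b z)) ^ 2 ∂ρ ≤
      2 * (∫ z, a z ^ 2 * X z ^ 2 ∂ρ + ∫ z, b z ^ 2 * X z ^ 2 ∂ρ) := by
    rw [← integral_add iaXX ibXX, ← integral_const_mul]
    refine integral_mono_of_nonneg (ae_of_all _ fun _ => sq_nonneg _)
      ((iaXX.add ibXX).const_mul 2) (ae_of_all _ fun z => ?_)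
    show (X z * √(g z) * (a z + b z)) ^ 2 ≤ 2 * (a z ^ 2 * X z ^ 2 + b z ^ 2 * X z ^ 2)
    rw [mul_pow, mul_pow, Real.sq_sqrt (hg0 z)]
    have h5 : X z ^ 2 * g z ≤ X z ^ 2 := mul_le_of_le_one_right (sq_nonneg _) (hg1 z)
    nlinarith [sq_nonneg (a z - b z), sq_nonneg (X z), sq_nonneg (a z + b z),
      mul_nonneg (sq_nonneg (X z)) (sq_nonneg (a z - b z)),
      mul_le_mul_of_nonneg_right h5 (sq_nonneg (a z + b z))]
  have e4 : ∫ z, (√(g z) * (a z - b z)) ^ 2 ∂ρ ≤ β := by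
    refine le_trans (le_of_eq ?_) h1
    congr 1
    ext z
    rw [mul_pow, Real.sq_sqrt (hg0 z), mul_comm]
  -- Split with `1 = (1 - g) + g`. On the first part the negative term `-b² X (1 - g)` is dropped;
  -- on the second, `a² - b² = (a - b)(a + b)`. Cauchy-Schwarz on each part uses one of the two
  -- hypotheses on `β`.
  have main : ∫ z, a z ^ 2 * X z ∂ρ - ∫ z, b z ^ 2 * X z ∂ρ ≤
      ∫ z, a z * X z * (a z * (1 - g z)) ∂ρ +
        ∫ z, X z * √(g z) * (a z + b z) * (√(g z) * (a z - b z)) ∂ρ := by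
    rw [← integral_sub iaX ibX, ← integral_add (key m1 m2 b1 b2) (key m3 m4 b3 b4)]
    refine integral_mono (iaX.sub ibX) ((key m1 m2 b1 b2).add (key m3 m4 b3 b4)) fun z => ?_
    show a z ^ 2 * X z - b z ^ 2 * X z ≤ a z * X z * (a z * (1 - g z)) +
      X z * √(g z) * (a z + b z) * (√(g z) * (a z - b z))
    have h6 : X z * √(g z) * (a z + b z) * (√(g z) * (a z - b z)) =
        X z * g z * (a z ^ 2 - b z ^ 2) := by
      linear_combination X z * (a z + b z) * (a z - b z) * Real.mul_self_sqrt (hg0 z)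
    rw [h6]
    have := mul_nonneg (mul_nonneg (hX0 z) (sq_nonneg (b z))) (sub_nonneg.mpr (hg1 z))
    nlinarith
  rw [e1] at c1
  have d1 := mul_le_mul_of_nonneg_left (Real.sqrt_le_sqrt e2)
    (Real.sqrt_nonneg (∫ z, a z ^ 2 * X z ^ 2 ∂ρ))
  have d2 := mul_le_mul (Real.sqrt_le_sqrt e3) (Real.sqrt_le_sqrt e4) (Real.sqrt_nonneg _)
    (Real.sqrt_nonneg _)
  linarith

/-! ### Product densities of history laws. -/

section History

variable {D O : Type*} [MeasurableSpace D] [MeasurableSpace O] {T : ℕ}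

lemma lintegral_roundKernel (alg : Algorithm T D O) (M : Fin T → Model D O) (t : ℕ)
    (ht : t < T) (h : Fin t → Round D O) {f : Round D O → ℝ≥0∞} (hf : Measurable f) :
    ∫⁻ x, f x ∂roundKernel alg M t ht h =
      ∫⁻ π, ∫⁻ z, f (π, z) ∂(M ⟨t, ht⟩).kernel π ∂alg.kernel t ht h := by
  rw [roundKernel, Kernel.lintegral_compProd _ _ _ hf]
  simp [Kernel.prodMkLeft_apply]

/-- If the model `K` has density `p` with respect to the model `N`, then the law of the history
under `K` has the product density with respect to the law of the history under `N`. -/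
lemma historyLaw_eq_withDensity (alg : Algorithm T D O) (K N : Model D O) {p : Round D O → ℝ}
    (hp : Measurable p) (hp0 : ∀ x, 0 ≤ p x)
    (hK : ∀ π, K.kernel π = (N.kernel π).withDensity fun z => ENNReal.ofReal (p (π, z)))
    (t : ℕ) (ht : t ≤ T) :
    historyLaw alg (fun _ => K) t ht = (historyLaw alg (fun _ => N) t ht).withDensity
      fun h => ENNReal.ofReal (∏ s, p (h s)) := by
  have hL : ∀ t : ℕ, Measurable fun h : Fin t → Round D O => ENNReal.ofReal (∏ s, p (h s)) :=
    fun t => ENNReal.measurable_ofReal.comp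
      (Finset.measurable_prod _ fun s _ => hp.comp (measurable_pi_apply s))
  induction t with
  | zero =>
    simp only [Finset.univ_eq_empty, Finset.prod_empty, ENNReal.ofReal_one]
    rw [show (fun _ : Fin 0 → Round D O => (1 : ℝ≥0∞)) = 1 from rfl, withDensity_one]
    rfl
  | succ t ih =>
    refine Measure.ext_of_lintegral _ fun f hf => ?_
    have hs := measurable_snoc t (R := Round D O)
    have hF : Measurable fun q : (Fin t → Round D O) × Round D O =>
        ENNReal.ofReal (p q.2) * f (Fin.snoc (α := fun _ => Round D O) q.1 q.2) :=
      ((ENNReal.measurable_ofReal.comp hp).comp measurable_snd).mul (hf.comp hs)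
    have hFh : ∀ h : Fin t → Round D O, Measurable fun x : Round D O =>
        ENNReal.ofReal (p x) * f (Fin.snoc (α := fun _ => Round D O) h x) :=
      fun h => hF.comp measurable_prodMk_left
    rw [lintegral_historyLaw_succ _ _ _ _ hf, lintegral_withDensity_eq_lintegral_mul _ (hL _) hf,
      lintegral_historyLaw_succ _ _ _ _ ((hL _).mul hf)]
    -- The decision kernel is common to both laws, so a round contributes only its feedback density.
    have e1 : ∀ h : Fin t → Round D O,
        ∫⁻ π, ∫⁻ z, f (Fin.snoc (α := fun _ => Round D O) h (π, z)) ∂K.kernel π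
          ∂alg.kernel t ht h =
        ∫⁻ x, ENNReal.ofReal (p x) * f (Fin.snoc (α := fun _ => Round D O) h x)
          ∂roundKernel alg (fun _ => N) t ht h := by
      intro h
      rw [lintegral_roundKernel _ _ _ _ _ (hFh h)]
      refine lintegral_congr fun π => ?_
      have m1 : Measurable fun z => ENNReal.ofReal (p (π, z)) :=
        ENNReal.measurable_ofReal.comp (hp.comp measurable_prodMk_left)
      have m2 : Measurable fun z => f (Fin.snoc (α := fun _ => Round D O) h (π, z)) :=
        (hf.comp hs).comp (measurable_const.prodMk (measurable_const.prodMk measurable_id))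
      rw [hK π, lintegral_withDensity_eq_lintegral_mul _ m1 m2]
      rfl
    simp_rw [e1]
    rw [ih (Nat.le_of_succ_le ht), lintegral_withDensity_eq_lintegral_mul _ (hL _)
      hF.lintegral_kernel_prod_right']
    refine lintegral_congr fun h => ?_
    simp only [Pi.mul_apply]
    rw [lintegral_roundKernel _ _ _ _ _ (hFh h),
      ← lintegral_const_mul']
    · refine lintegral_congr fun π => ?_
      rw [← lintegral_const_mul' _ _ ENNReal.ofReal_ne_top]
      refine lintegral_congr fun z => ?_
      rw [Fin.prod_univ_castSucc, ENNReal.ofReal_mul (Finset.prod_nonneg fun _ _ => hp0 _)]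
      simp only [Fin.snoc_castSucc, Fin.snoc_last, mul_assoc]
    · exact ENNReal.ofReal_ne_top

variable [Finite D] [MeasurableSingletonClass D]

/-- The equal-weight mixture of two models. -/
noncomputable def midModel (P Q : Model D O) : Model D O where
  kernel := Kernel.ofFunOfCountable fun π => midMeasure (P.kernel π) (Q.kernel π)
  isMarkov := ⟨fun π => inferInstanceAs
    (IsProbabilityMeasure (midMeasure (P.kernel π) (Q.kernel π)))⟩

/-- Since `D` is countable, densities chosen separately for each decision glue to a jointly
measurable one. -/
lemma exists_model_density (P Q : Model D O) :
    ∃ p : Round D O → ℝ, Measurable p ∧ (∀ x, 0 ≤ p x) ∧ (∀ x, p x ≤ 2) ∧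
      (∀ π, P.kernel π =
        ((midModel P Q).kernel π).withDensity fun z => ENNReal.ofReal (p (π, z))) ∧
      (∀ π, Q.kernel π =
        ((midModel P Q).kernel π).withDensity fun z => ENNReal.ofReal (2 - p (π, z))) ∧
      (∀ π, hellingerSq (P.kernel π) (Q.kernel π) =
        ∫ z, (√(p (π, z)) - √(2 - p (π, z))) ^ 2 ∂((midModel P Q).kernel π)) := by
  choose p h1 h2 h3 h4 h5 h6 using fun π => exists_density (P.kernel π) (Q.kernel π)
  exact ⟨fun x => p x.1 x.2, measurable_from_prod_countable_right h1, fun x => h2 _ _,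
    fun x => h3 _ _, h4, h5, h6⟩

/-- The summand of round `t` is a function of the first `t` rounds alone, so it integrates against
the shorter history law. -/
lemma integral_cum_succ (alg : Algorithm T D O) (M : Fin T → Model D O) (φ : Fin T → D → ℝ)
    (t : ℕ) (ht : t + 1 ≤ T) :
    ∫ h, cum alg φ (t + 1) ht h ∂historyLaw alg M (t + 1) ht =
      ∫ h, cum alg φ t (Nat.le_of_succ_le ht) h ∂historyLaw alg M t (Nat.le_of_succ_le ht) +
      ∫ h, ∫ π, φ ⟨t, ht⟩ π ∂alg.kernel t ht h
        ∂historyLaw alg M t (Nat.le_of_succ_le ht) := by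
  obtain ⟨K, hK⟩ := exists_abs_le φ
  rw [integral_historyLaw_succ _ _ _ _ (measurable_cum _ _ _ _)
    (abs_cum_le alg hK (t + 1) ht), ← integral_add]
  · simp [cum_succ]
  · exact integrable_of_abs_le (measurable_cum _ _ _ _) (abs_cum_le alg hK t _)
  · have h1 : StronglyMeasurable (φ ⟨t, ht⟩) := Measurable.of_discrete.stronglyMeasurable
    refine integrable_of_abs_le (h1.integral_kernel (κ := alg.kernel t ht)).measurable
      (C := K) fun h => ?_
    have := norm_integral_le_of_norm_le_const (μ := alg.kernel t ht h) (f := φ ⟨t, ht⟩) (C := K)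
      (ae_of_all _ fun π => by simpa using hK ⟨t, ht⟩ π)
    simpa using this

end History

/-! ### The discounted Hellinger potential along the history. -/

section History

variable {D O : Type*} [MeasurableSpace D] [MeasurableSpace O] {T : ℕ}

lemma prod_density_nonneg {R : Type*} {p : R → ℝ} (hp0 : ∀ x, 0 ≤ p x) {t : ℕ} (h : Fin t → R) :
    0 ≤ ∏ s, p (h s) :=
  Finset.prod_nonneg fun _ _ => hp0 _

lemma prod_density_le {R : Type*} {p : R → ℝ} (hp0 : ∀ x, 0 ≤ p x) (hp2 : ∀ x, p x ≤ 2) {t : ℕ}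
    (h : Fin t → R) : ∏ s, p (h s) ≤ 2 ^ t := by
  simpa using Finset.prod_le_prod (s := Finset.univ) (fun s _ => hp0 (h s)) (fun s _ => hp2 (h s))

lemma measurable_prod_density {R : Type*} [MeasurableSpace R] {p : R → ℝ} (hp : Measurable p)
    (t : ℕ) : Measurable fun h : Fin t → R => ∏ s, p (h s) :=
  Finset.measurable_prod _ fun s _ => hp.comp (measurable_pi_apply s)

lemma sq_sqrt_sub_sqrt_le {x y K : ℝ} (hx : 0 ≤ x) (hy : 0 ≤ y) (hxK : x ≤ K) (hyK : y ≤ K) :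
    (√x - √y) ^ 2 ≤ 2 * K := by
  nlinarith [Real.sq_sqrt hx, Real.sq_sqrt hy, Real.sqrt_nonneg x, Real.sqrt_nonneg y,
    mul_nonneg (Real.sqrt_nonneg x) (Real.sqrt_nonneg y)]

lemma integral_historyLaw_eq (alg : Algorithm T D O) (K N : Model D O) {p : Round D O → ℝ}
    (hp : Measurable p) (hp0 : ∀ x, 0 ≤ p x)
    (hK : ∀ π, K.kernel π = (N.kernel π).withDensity fun z => ENNReal.ofReal (p (π, z)))
    (t : ℕ) (ht : t ≤ T) (X : (Fin t → Round D O) → ℝ) :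
    ∫ h, X h ∂historyLaw alg (fun _ => K) t ht =
      ∫ h, (∏ s, p (h s)) * X h ∂historyLaw alg (fun _ => N) t ht := by
  rw [historyLaw_eq_withDensity alg K N hp hp0 hK,
    integral_withDensity_ofReal _ (measurable_prod_density hp t) (prod_density_nonneg hp0)]

/-- One-round mixture of two densities and of their geometric mean. -/
lemma integral_density_combination {Z : Type*} [MeasurableSpace Z] {N P : Measure Z}
    [IsProbabilityMeasure N] [IsProbabilityMeasure P] {p : Z → ℝ}
    (hp : Measurable p) (hp0 : ∀ z, 0 ≤ p z) (hp2 : ∀ z, p z ≤ 2)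
    (hP : P = N.withDensity fun z => ENNReal.ofReal (p z))
    (a b : ℝ) :
    ∫ z, (a * √(p z) - b * √(2 - p z)) ^ 2 ∂N =
      (a - b) ^ 2 + a * b * ∫ z, (√(p z) - √(2 - p z)) ^ 2 ∂N := by
  have hq0 : ∀ z, 0 ≤ 2 - p z := fun z => by linarith [hp2 z]
  have h1 : ∫ z, p z ∂N = 1 := by
    have := integral_withDensity_ofReal N hp hp0 (fun _ => (1 : ℝ))
    rw [← hP] at this
    simpa using this.symm
  have i1 : Integrable p N := integrable_of_abs_le hp (C := 2) fun z => by
    rw [abs_of_nonneg (hp0 z)]; exact hp2 z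
  have i2 : Integrable (fun z => (√(p z) - √(2 - p z)) ^ 2) N :=
    integrable_of_abs_le (by fun_prop) (C := 2 * 2) fun z => by
      rw [abs_of_nonneg (sq_nonneg _)]
      exact sq_sqrt_sub_sqrt_le (hp0 z) (hq0 z) (hp2 z) (by linarith [hp0 z])
  -- As the densities sum to 2, the cross term `√p √(2 - p)` is `1 - (√p - √(2 - p))² / 2`. The rest
  -- is affine in `p`, whose integral is 1.
  have e : (fun z => (a * √(p z) - b * √(2 - p z)) ^ 2) = fun z =>
      (a ^ 2 - b ^ 2) * p z + (2 * b ^ 2 - 2 * a * b) + a * b * (√(p z) - √(2 - p z)) ^ 2 := by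
    ext z
    linear_combination (a ^ 2 - a * b) * Real.sq_sqrt (hp0 z) +
      (b ^ 2 - a * b) * Real.sq_sqrt (hq0 z)
  have i3 : Integrable (fun z => (a ^ 2 - b ^ 2) * p z + (2 * b ^ 2 - 2 * a * b)) N :=
    (i1.const_mul _).add (integrable_const _)
  rw [e, integral_add i3 (i2.const_mul _), integral_add (i1.const_mul _) (integrable_const _),
    integral_const_mul, integral_const_mul, h1]
  simp
  ring

/-- One step of the potential: `a²` and `b²` are the two likelihoods so far, `c` the accumulated
distance, `δ` its increment. The form `4a² - 5ab + 2b²` is positive definite, so `ab ≤ 2a² + 2(a -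
b)²`. The growth factor `1 + 2δ` is then cancelled by the extra discount `exp (-2δ)`, and the
remainder `2a²δ` is charged to the first likelihood only. -/
lemma exp_potential_le {a b c δ : ℝ} (hδ : 0 ≤ δ) (hc : 0 ≤ c) :
    Real.exp (-2 * (c + δ)) * ((a - b) ^ 2 + a * b * δ) ≤
      (a - b) ^ 2 * Real.exp (-2 * c) + 2 * (a ^ 2 * δ) := by
  have h1 : Real.exp (-2 * (c + δ)) = Real.exp (-2 * c) * Real.exp (-2 * δ) := by
    rw [← Real.exp_add]; ring_nf
  have h2 : Real.exp (-2 * δ) * (1 + 2 * δ) ≤ 1 := by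
    have := mul_le_mul_of_nonneg_left (Real.add_one_le_exp (2 * δ)) (Real.exp_pos (-2 * δ)).le
    rw [← Real.exp_add] at this
    ring_nf at this ⊢
    simpa using this
  have h3 : Real.exp (-2 * (c + δ)) ≤ 1 := Real.exp_le_one_iff.mpr (by linarith)
  have h4 : a * b * δ ≤ (2 * a ^ 2 + 2 * (a - b) ^ 2) * δ :=
    mul_le_mul_of_nonneg_right (by nlinarith [sq_nonneg (a - b), sq_nonneg (4 * a - 5 / 2 * b)]) hδ
  calc Real.exp (-2 * (c + δ)) * ((a - b) ^ 2 + a * b * δ)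
      ≤ Real.exp (-2 * (c + δ)) * ((a - b) ^ 2 * (1 + 2 * δ) + 2 * a ^ 2 * δ) :=
        mul_le_mul_of_nonneg_left (by linarith) (Real.exp_pos _).le
    _ = (a - b) ^ 2 * Real.exp (-2 * c) * (Real.exp (-2 * δ) * (1 + 2 * δ)) +
        Real.exp (-2 * (c + δ)) * (2 * a ^ 2 * δ) := by rw [mul_add, h1]; ring
    _ ≤ (a - b) ^ 2 * Real.exp (-2 * c) * 1 + 1 * (2 * a ^ 2 * δ) :=
        add_le_add (mul_le_mul_of_nonneg_left h2 (by positivity))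
          (mul_le_mul_of_nonneg_right h3 (by positivity))
    _ = _ := by ring

lemma abs_integral_le {μ : Measure D} [IsProbabilityMeasure μ] {φ : D → ℝ} {K : ℝ}
    (hK : ∀ π, |φ π| ≤ K) : |∫ π, φ π ∂μ| ≤ K := by
  have := norm_integral_le_of_norm_le_const (μ := μ) (f := φ) (C := K)
    (ae_of_all _ fun π => by simpa using hK π)
  simpa using this

variable [Finite D] [MeasurableSingletonClass D]

/-- The squared Hellinger distance between the laws of the histories, discounted along the path,
is at most twice the expected sum of the one-round squared Hellinger distances. -/
lemma integral_discounted_hellinger_le (alg : Algorithm T D O) (P Q : Model D O)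
    {p : Round D O → ℝ} (hp : Measurable p) (hp0 : ∀ x, 0 ≤ p x) (hp2 : ∀ x, p x ≤ 2)
    (hP : ∀ π, P.kernel π =
      ((midModel P Q).kernel π).withDensity fun z => ENNReal.ofReal (p (π, z)))
    (hH : ∀ π, hellingerSq (P.kernel π) (Q.kernel π) =
        ∫ z, (√(p (π, z)) - √(2 - p (π, z))) ^ 2 ∂((midModel P Q).kernel π))
    (t : ℕ) (ht : t ≤ T) :
    ∫ h, (√(∏ s, p (h s)) - √(∏ s, (2 - p (h s)))) ^ 2 * Real.exp (-2 *
        cum alg (fun _ π => hellingerSq (P.kernel π) (Q.kernel π)) t ht h)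
        ∂historyLaw alg (fun _ => midModel P Q) t ht ≤
      2 * ∫ h, cum alg (fun _ π => hellingerSq (P.kernel π) (Q.kernel π)) t ht h
        ∂historyLaw alg (fun _ => P) t ht := by
  have hq0 : ∀ x, 0 ≤ 2 - p x := fun x => by linarith [hp2 x]
  have hq2 : ∀ x, 2 - p x ≤ 2 := fun x => by linarith [hp0 x]
  have hq : Measurable fun x => 2 - p x := measurable_const.sub hp
  set d : D → ℝ := fun π => hellingerSq (P.kernel π) (Q.kernel π) with hd
  have hd0 : ∀ π, 0 ≤ d π := fun π => hellingerSq_nonneg _ _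
  set N := midModel P Q with hN
  have hB0 : ∀ t ht h, 0 ≤ cum alg (fun _ => d) t ht h := fun t ht h =>
    cum_nonneg alg (fun _ => hd0) t ht h
  have hmeas : ∀ (t : ℕ) (ht : t ≤ T), Measurable fun h : Fin t → Round D O =>
      (√(∏ s, p (h s)) - √(∏ s, (2 - p (h s)))) ^ 2 *
        Real.exp (-2 * cum alg (fun _ => d) t ht h) := fun t ht =>
    (((measurable_prod_density hp t).sqrt.sub (measurable_prod_density hq t).sqrt).pow_const 2).mul
      (((measurable_cum alg (fun _ => d) t ht).const_mul (-2)).exp)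
  have hbd : ∀ (t : ℕ) (ht : t ≤ T) (h : Fin t → Round D O),
      |(√(∏ s, p (h s)) - √(∏ s, (2 - p (h s)))) ^ 2 *
        Real.exp (-2 * cum alg (fun _ => d) t ht h)| ≤ 2 * 2 ^ t := fun t ht h => by
    rw [abs_of_nonneg (by positivity)]
    exact (mul_le_of_le_one_right (sq_nonneg _)
      (Real.exp_le_one_iff.mpr (by linarith [hB0 t ht h]))).trans
      (sq_sqrt_sub_sqrt_le (prod_density_nonneg hp0 h) (prod_density_nonneg hq0 h)
        (prod_density_le hp0 hp2 h) (prod_density_le hq0 hq2 h))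
  induction t with
  | zero => simp [cum_zero]
  | succ t ih =>
    have ht' := Nat.le_of_succ_le ht
    obtain ⟨K, hK⟩ := exists_abs_le fun _ : Unit => d
    let δ : (Fin t → Round D O) → ℝ := fun h => ∫ π, d π ∂alg.kernel t ht h
    have hδ : Measurable δ :=
      ((Measurable.of_discrete (f := d)).stronglyMeasurable.integral_kernel
        (κ := alg.kernel t ht)).measurable
    have hδ0 : ∀ h, 0 ≤ δ h := fun h => integral_nonneg hd0
    have hδK : ∀ h, |δ h| ≤ K := fun h => abs_integral_le (hK ())
    have hK0 : ∀ h, δ h ≤ K := fun h => (le_abs_self _).trans (hδK h)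
    rw [integral_historyLaw_succ _ _ _ _ (hmeas (t + 1) ht) (hbd (t + 1) ht), integral_cum_succ,
      mul_add]
    -- The new discount depends only on `h`, so it leaves the integral over the round; averaging
    -- over the decision turns `d π` into `δ h`.
    have step : ∀ h : Fin t → Round D O, ∫ π, ∫ z,
        (√(∏ s, p (Fin.snoc (α := fun _ => Round D O) h (π, z) s)) -
          √(∏ s, (2 - p (Fin.snoc (α := fun _ => Round D O) h (π, z) s)))) ^ 2 *
        Real.exp (-2 * cum alg (fun _ => d) (t + 1) ht
          (Fin.snoc (α := fun _ => Round D O) h (π, z))) ∂N.kernel π ∂alg.kernel t ht h =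
        Real.exp (-2 * (cum alg (fun _ => d) t ht' h + δ h)) *
          ((√(∏ s, p (h s)) - √(∏ s, (2 - p (h s)))) ^ 2 +
            √(∏ s, p (h s)) * √(∏ s, (2 - p (h s))) * δ h) := by
      intro h
      have inner : ∀ π, ∫ z, (√(∏ s, p (Fin.snoc (α := fun _ => Round D O) h (π, z) s)) -
          √(∏ s, (2 - p (Fin.snoc (α := fun _ => Round D O) h (π, z) s)))) ^ 2 *
        Real.exp (-2 * cum alg (fun _ => d) (t + 1) ht
          (Fin.snoc (α := fun _ => Round D O) h (π, z))) ∂N.kernel π =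
          Real.exp (-2 * (cum alg (fun _ => d) t ht' h + δ h)) *
          ((√(∏ s, p (h s)) - √(∏ s, (2 - p (h s)))) ^ 2 +
            √(∏ s, p (h s)) * √(∏ s, (2 - p (h s))) * d π) := by
        intro π
        have e := integral_density_combination (N := N.kernel π) (p := fun z => p (π, z))
          (hp.comp measurable_prodMk_left) (fun z => hp0 _) (fun z => hp2 _) (hP π)
          √(∏ s, p (h s)) √(∏ s, (2 - p (h s)))
        rw [← hH π] at e
        rw [← e, ← integral_const_mul]
        congr 1
        ext z
        rw [cum_succ, Fin.prod_univ_castSucc, Fin.prod_univ_castSucc]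
        simp only [Fin.snoc_castSucc, Fin.snoc_last]
        rw [Real.sqrt_mul (prod_density_nonneg hp0 h), Real.sqrt_mul (prod_density_nonneg hq0 h),
          mul_comm]
      simp_rw [inner]
      rw [integral_const_mul, integral_add (integrable_const _) (integrable_of_finite _ _),
        integral_const_mul]
      simp [δ]
    simp_rw [step]
    have hAm := measurable_prod_density hp t
    have iA : Integrable (fun h => (∏ s, p (h s)) * δ h)
        (historyLaw alg (fun _ => N) t ht') :=
      integrable_of_abs_le (hAm.mul hδ) (C := 2 ^ t * K) fun h => by
        rw [abs_mul, abs_of_nonneg (prod_density_nonneg hp0 h)]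
        exact mul_le_mul (prod_density_le hp0 hp2 h) (hδK h) (abs_nonneg _) (by positivity)
    have iW := integrable_of_abs_le (μ := historyLaw alg (fun _ => N) t ht') (hmeas t ht')
      (hbd t ht')
    calc _ ≤ ∫ h, ((√(∏ s, p (h s)) - √(∏ s, (2 - p (h s)))) ^ 2 *
          Real.exp (-2 * cum alg (fun _ => d) t ht' h) + 2 * ((∏ s, p (h s)) * δ h))
          ∂historyLaw alg (fun _ => N) t ht' := by
          refine integral_mono_of_nonneg (ae_of_all _ fun h => ?_) (iW.add (iA.const_mul 2))
            (ae_of_all _ fun h => ?_)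
          · have := hδ0 h
            show 0 ≤ Real.exp (-2 * (cum alg (fun _ => d) t ht' h + δ h)) *
              ((√(∏ s, p (h s)) - √(∏ s, (2 - p (h s)))) ^ 2 +
                √(∏ s, p (h s)) * √(∏ s, (2 - p (h s))) * δ h)
            positivity
          · have := exp_potential_le (a := √(∏ s, p (h s))) (b := √(∏ s, (2 - p (h s))))
              (hδ0 h) (hB0 t ht' h)
            rwa [Real.sq_sqrt (prod_density_nonneg hp0 h)] at this
      _ ≤ _ := by
          rw [integral_add iW (iA.const_mul 2), integral_const_mul]
          -- Weighting by the likelihood of `P` turns the remainder into the increment of the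
          -- right-hand side, an expectation under `P`.
          refine add_le_add (ih ht') (le_of_eq ?_)
          rw [integral_historyLaw_eq alg P N hp hp0 hP]

/-- Change of measure between the laws of the histories under two models, in terms of the expected
sum of the one-round squared Hellinger distances under the first model. -/
theorem integral_historyLaw_le (alg : Algorithm T D O) (P Q : Model D O)
    {X : (Fin T → Round D O) → ℝ} (hX : Measurable X) (hX0 : ∀ h, 0 ≤ X h) (hX1 : ∀ h, X h ≤ 1)
    {β : ℝ} (hβ : 2 * ∫ h, cum alg (fun _ π => hellingerSq (P.kernel π) (Q.kernel π)) T le_rfl h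
        ∂historyLaw alg (fun _ => P) T le_rfl ≤ β) :
    ∫ h, X h ∂historyLaw alg (fun _ => P) T le_rfl ≤
      ∫ h, X h ∂historyLaw alg (fun _ => Q) T le_rfl +
      √β * (√(∫ h, X h ^ 2 ∂historyLaw alg (fun _ => P) T le_rfl) +
        √(2 * (∫ h, X h ^ 2 ∂historyLaw alg (fun _ => P) T le_rfl +
          ∫ h, X h ^ 2 ∂historyLaw alg (fun _ => Q) T le_rfl))) := by
  obtain ⟨p, hp, hp0, hp2, hP, hQ, hH⟩ := exists_model_density P Q
  have hq0 : ∀ x, 0 ≤ 2 - p x := fun x => by linarith [hp2 x]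
  have hq2 : ∀ x, 2 - p x ≤ 2 := fun x => by linarith [hp0 x]
  have hq : Measurable fun x => 2 - p x := measurable_const.sub hp
  have hpot := integral_discounted_hellinger_le alg P Q hp hp0 hp2 hP hH T le_rfl
  set d : Fin T → D → ℝ := fun _ π => hellingerSq (P.kernel π) (Q.kernel π) with hd
  have hB0 : ∀ h, 0 ≤ cum alg d T le_rfl h := fun h =>
    cum_nonneg alg (fun _ _ => hellingerSq_nonneg _ _) T le_rfl h
  obtain ⟨K, hK⟩ := exists_abs_le d
  have eP := integral_historyLaw_eq alg P (midModel P Q) hp hp0 hP T le_rfl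
  have eQ := integral_historyLaw_eq alg Q (midModel P Q) hq hq0 hQ T le_rfl
  have hmB := measurable_cum alg d T le_rfl
  -- Here `a`, `b` are the roots of the likelihoods and `g` is the discount. The first condition on
  -- `β` is the potential bound; the second follows from `1 - exp (-x) ≤ x`, integrated under `P`.
  have := integral_sq_mul_le (ρ := historyLaw alg (fun _ => midModel P Q) T le_rfl)
    (a := fun h => √(∏ s, p (h s))) (b := fun h => √(∏ s, (2 - p (h s))))
    (g := fun h => Real.exp (-2 * cum alg d T le_rfl h)) (X := X)
    (measurable_prod_density hp T).sqrt (measurable_prod_density hq T).sqrt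
    ((hmB.const_mul (-2)).exp) hX (C := √(2 ^ T)) (fun _ => Real.sqrt_nonneg _)
    (fun _ => Real.sqrt_nonneg _) (fun _ => (Real.exp_pos _).le) hX0
    (fun h => Real.sqrt_le_sqrt (prod_density_le hp0 hp2 h))
    (fun h => Real.sqrt_le_sqrt (prod_density_le hq0 hq2 h))
    (fun h => Real.exp_le_one_iff.mpr (by linarith [hB0 h])) hX1 (β := β) (hpot.trans hβ) ?_
  · simp only [Real.sq_sqrt (prod_density_nonneg hp0 _),
      Real.sq_sqrt (prod_density_nonneg hq0 _)] at this
    rwa [← eP, ← eQ, ← eP, ← eQ] at this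
  · simp only [Real.sq_sqrt (prod_density_nonneg hp0 _)]
    rw [← eP]
    refine le_trans ?_ hβ
    rw [← integral_const_mul]
    refine integral_mono_of_nonneg (ae_of_all _ fun h => ?_)
      ((integrable_of_abs_le hmB (abs_cum_le alg hK T le_rfl)).const_mul 2)
      (ae_of_all _ fun h => ?_)
    · exact sub_nonneg.mpr (Real.exp_le_one_iff.mpr (by linarith [hB0 h]))
    · show 1 - Real.exp (-2 * cum alg d T le_rfl h) ≤ 2 * cum alg d T le_rfl h
      linarith [Real.add_one_le_exp (-2 * cum alg d T le_rfl h)]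

end History

/-! ### Elementary inequalities and default values of real suprema and infima. -/

lemma sq_le_imp_le_add {s a b k : ℝ} (ha : 0 ≤ a) (hk : 0 ≤ k) (h : s ^ 2 ≤ s * a + b)
    (hb : b ≤ k ^ 2) : s ≤ a + k := by
  by_contra hlt
  push Not at hlt
  nlinarith

/-- The elementary inequality behind the lower bound: `y` and `s` are the first and the second
moment of the regret under the nominal law, `u` and `v` bound second moments of actual regrets, and
`δ` is the average Hellinger distance. -/
lemma lower_bound_arith {τ δ r y s u v γ ε C : ℝ} (hτ : 0 < τ) (hδ : 0 ≤ δ) (hr : 0 ≤ r)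
    (hu : 0 ≤ u) (hv : 0 ≤ v) (hC : 128 ≤ C)
    (hγ : 2 * C * τ ^ 2 ≤ γ ^ 2) (hγ0 : 0 < γ) (hε : ε = γ / (4 * C * τ ^ 2))
    (h1 : r + γ * δ ^ 2 ≤ y) (h2 : y ≤ s) (h3 : s ^ 2 ≤ s * (v + 2 * δ) + ε * y)
    (h4 : y ≤ u + 3 / 2 * (τ * δ) * (5 / 2 * s + 3 / 2 * u)) :
    r ≤ 5 * u + 5 * v := by
  have hτ2 : 0 < τ ^ 2 := by positivity
  -- `16 = √(2 · 128)`; likewise `512 = 4 · 128` below.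
  have hγτ : 16 * τ ≤ γ := by
    refine (sq_le_sq₀ (by positivity) hγ0.le).mp ?_
    nlinarith
  have hε0 : 0 < ε := by rw [hε]; positivity
  have hετ : ε * τ ^ 2 ≤ γ / 512 := by
    have hC0 : (0 : ℝ) < C := by linarith
    have : ε * τ ^ 2 = γ / (4 * C) := by rw [hε]; field_simp
    rw [this]
    exact div_le_div_of_nonneg_left hγ0.le (by norm_num) (by linarith)
  have hy0 : 0 ≤ y := le_trans (by positivity) h1
  have hg : 0 ≤ γ * δ ^ 2 := by positivity
  have hτδ : τ * δ ^ 2 ≤ γ * δ ^ 2 / 16 := by nlinarith [sq_nonneg δ]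
  have hεδ : ε * (τ * δ) ^ 2 ≤ γ * δ ^ 2 / 512 := by
    have := mul_le_mul_of_nonneg_right hετ (sq_nonneg δ)
    nlinarith
  have hk := Real.sq_sqrt (mul_nonneg hε0.le hy0)
  have hk0 := Real.sqrt_nonneg (ε * y)
  have hs' : s ≤ v + 2 * δ + √(ε * y) :=
    sq_le_imp_le_add (by linarith) hk0 h3 hk.ge
  -- The weights let `y / 16` be absorbed on the left, while `4 ε θ²` costs at most `γ δ² / 128`
  -- when `θ = τ δ`.
  have amgm : ∀ θ : ℝ, 0 ≤ θ → θ * √(ε * y) ≤ 4 * (ε * θ ^ 2) + y / 16 := by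
    intro θ hθ
    refine (sq_le_sq₀ (by positivity) (by positivity)).mp ?_
    rw [mul_pow, hk]
    nlinarith [sq_nonneg (4 * (ε * θ ^ 2) - y / 16)]
  set θ := τ * δ with hθ
  have hθ0 : 0 ≤ θ := by positivity
  -- `θ²` is the total Hellinger distance. If `θ ≥ 1`, then `δ ≤ τ δ²` is absorbed by `γ δ²` and `y
  -- ≤ s` suffices. If `θ ≤ 1`, the change of measure `h4` is used, with `θ` damping `s`. There
  -- `15/64` of `y` is absorbed, and `(15/4) / (49/64) < 5` accounts for the constant 5.
  rcases le_total 1 θ with hcase | hcase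
  · have ha := amgm 1 zero_le_one
    have hδθ : δ ≤ τ * δ ^ 2 := by nlinarith
    have hεθ : ε ≤ ε * θ ^ 2 := le_mul_of_one_le_right hε0.le (one_le_pow₀ hcase)
    linarith
  · have ha := amgm θ hθ0
    have h5 : θ * s ≤ θ * (v + 2 * δ + √(ε * y)) := mul_le_mul_of_nonneg_left hs' hθ0
    have h6 : θ * v ≤ v := by nlinarith
    have h7 : θ * u ≤ u := by nlinarith
    have h8 : θ * δ = τ * δ ^ 2 := by rw [hθ]; ring
    have h9 : 3 / 2 * θ * (5 / 2 * s + 3 / 2 * u) = 15 / 4 * (θ * s) + 9 / 4 * (θ * u) := by ring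
    have h10 : θ * (v + 2 * δ + √(ε * y)) = θ * v + 2 * (θ * δ) + θ * √(ε * y) := by ring
    linarith

/-- An empty supremum is 0 by convention, which `0 ≤ r` rules out; no upper bound is required. -/
lemma exists_lt_of_lt_real_iSup {ι : Type*} {f : ι → ℝ} {r : ℝ} (hr : 0 ≤ r) (h : r < ⨆ i, f i) :
    ∃ i, r < f i := by
  rcases isEmpty_or_nonempty ι with hι | hι
  · rw [Real.iSup_of_isEmpty] at h
    exact absurd h hr.not_gt
  · exact exists_lt_of_lt_ciSup h

/-- An infimum that is unbounded below defaults to 0, which `0 ≤ r` rules out. -/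
lemma lt_of_lt_real_iInf {ι : Type*} {f : ι → ℝ} {r : ℝ} (hr : 0 ≤ r) (h : r < ⨅ i, f i) (i : ι) :
    r < f i := by
  refine h.trans_le (ciInf_le ?_ i)
  by_contra hb
  rw [Real.iInf_of_not_bddBelow hb] at h
  exact absurd h hr.not_gt

/-! ### Mean rewards and suboptimality gaps. -/

section Models

lemma abs_reward_le {O : Type*} (z : Feedback O) : |(z.1 : ℝ)| ≤ 1 := by
  rw [abs_of_nonneg z.1.2.1]; exact z.1.2.2

variable {D O : Type*} [MeasurableSpace D] [MeasurableSpace O]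

lemma measurable_reward : Measurable fun z : Feedback O => (z.1 : ℝ) := by fun_prop

lemma Model.mean_nonneg (M : Model D O) (π : D) : 0 ≤ M.mean π :=
  integral_nonneg fun z => z.1.2.1

lemma Model.mean_le_one (M : Model D O) (π : D) : M.mean π ≤ 1 := by
  have := integral_mono_of_nonneg (μ := M.kernel π) (f := fun z : Feedback O => (z.1 : ℝ))
    (g := fun _ => 1) (ae_of_all _ fun z => z.1.2.1) (integrable_const _)
    (ae_of_all _ fun z => z.1.2.2)
  simpa [Model.mean] using this

/-- The suboptimality gap of a decision. -/
noncomputable def Model.gap (M : Model D O) (π : D) : ℝ := M.opt - M.mean π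

variable [Finite D]

lemma Model.mean_le_opt (M : Model D O) (π : D) : M.mean π ≤ M.opt :=
  le_ciSup (Set.finite_range M.mean).bddAbove π

lemma Model.gap_nonneg (M : Model D O) (π : D) : 0 ≤ M.gap π := sub_nonneg.mpr (M.mean_le_opt π)

lemma Model.exists_mean_eq_opt [Nonempty D] (M : Model D O) : ∃ π, M.mean π = M.opt :=
  exists_eq_ciSup_of_finite

lemma Model.gap_le_one [Nonempty D] (M : Model D O) (π : D) : M.gap π ≤ 1 := by
  obtain ⟨π', h⟩ := M.exists_mean_eq_opt
  have := M.mean_le_one π'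
  have := M.mean_nonneg π
  unfold Model.gap
  linarith

end Models

/-! ### From the coefficient to a model with a large average gap. -/

section DecisionLaw

variable {D O : Type*} [MeasurableSpace D] [MeasurableSpace O] {T : ℕ}

/-- The law of the decision in a round drawn uniformly at random. -/
noncomputable def decisionLaw (alg : Algorithm T D O) (M : Fin T → Model D O) : Measure D :=
  (T : ℝ≥0∞)⁻¹ • ∑ t : Fin T, alg.kernel t t.2 ∘ₘ historyLaw alg M t t.2.le

lemma isProbabilityMeasure_decisionLaw (alg : Algorithm T D O) (M : Fin T → Model D O)
    (hT : T ≠ 0) : IsProbabilityMeasure (decisionLaw alg M) := by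
  refine ⟨?_⟩
  simp only [decisionLaw, Measure.smul_apply, Measure.finsetSum_apply, measure_univ, smul_eq_mul,
    Finset.sum_const, Finset.card_univ, Fintype.card_fin, nsmul_eq_mul, mul_one]
  exact ENNReal.inv_mul_cancel (by simpa using hT) (ENNReal.natCast_ne_top T)

variable [Finite D] [MeasurableSingletonClass D]

lemma integral_cum_const (alg : Algorithm T D O) (M : Fin T → Model D O) (φ : D → ℝ)
    (t : ℕ) (ht : t ≤ T) :
    ∫ h, cum alg (fun _ => φ) t ht h ∂historyLaw alg M t ht =
      ∑ s : Fin t, ∫ π, φ π ∂(alg.kernel s (s.2.trans_le ht) ∘ₘ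
        historyLaw alg M s (s.2.le.trans ht)) := by
  induction t with
  | zero => simp [cum_zero]
  | succ t ih =>
    rw [integral_cum_succ, ih, Fin.sum_univ_castSucc]
    congr 1
    rw [Measure.comp_eq_comp_const_apply, Kernel.integral_comp (integrable_of_finite _ _)]
    simp

lemma integral_decisionLaw (alg : Algorithm T D O) (M : Fin T → Model D O) (φ : D → ℝ) :
    ∫ π, φ π ∂decisionLaw alg M =
      (T : ℝ)⁻¹ * ∫ h, cum alg (fun _ => φ) T le_rfl h ∂historyLaw alg M T le_rfl := by
  rw [decisionLaw, integral_smul_measure,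
    integral_finsetSum_measure fun t _ => integrable_of_finite _ _, integral_cum_const]
  simp

/-- The average over the rounds of the conditional expectation of the suboptimality gap. -/
noncomputable def avgGap (alg : Algorithm T D O) (M : Model D O) (h : Fin T → Round D O) : ℝ :=
  (T : ℝ)⁻¹ * cum alg (fun _ => M.gap) T le_rfl h

lemma measurable_avgGap (alg : Algorithm T D O) (M : Model D O) : Measurable (avgGap alg M) :=
  (measurable_cum alg _ T le_rfl).const_mul _

lemma avgGap_nonneg (alg : Algorithm T D O) (M : Model D O) (h : Fin T → Round D O) :
    0 ≤ avgGap alg M h :=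
  mul_nonneg (by positivity) (cum_nonneg alg (fun _ => M.gap_nonneg) T le_rfl h)

lemma avgGap_le_one [Nonempty D] (alg : Algorithm T D O) (M : Model D O) (h : Fin T → Round D O) :
    avgGap alg M h ≤ 1 := by
  have := cum_mono alg (ψ := fun _ _ => 1) (fun _ => M.gap_le_one) T le_rfl h
  rw [cum_const, mul_one] at this
  exact inv_mul_le_one_of_le₀ this (by positivity)

/-- Some model of the class forces a large second moment of the average gap. -/
theorem exists_le_sqrt_integral_avgGap_sq [Nonempty D] (alg : Algorithm T D O) (hT : T ≠ 0)
    (𝓝 : Set (Model D O)) {γ ε C r : ℝ} (hC : 128 ≤ C) (hγ : √(2 * C * T) < γ)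
    (hε : ε = γ / (4 * C * T)) (hr : 0 ≤ r) (h : r < decLoc γ ε 𝓝) :
    ∃ M ∈ 𝓝, r ≤ 10 * √(∫ h, avgGap alg M h ^ 2 ∂historyLaw alg (fun _ => M) T le_rfl) := by
  obtain ⟨⟨P, hPN⟩, hP⟩ := exists_lt_of_lt_real_iSup hr h
  have hT0 : (0 : ℝ) < T := Nat.cast_pos.mpr (Nat.pos_of_ne_zero hT)
  have := isProbabilityMeasure_decisionLaw alg (fun _ => P) hT
  -- The infimum is tested at the algorithm's own average play against `P`, so `Q` is tailored to
  -- the algorithm.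
  obtain ⟨⟨Q, hQN, hQ⟩, hlt⟩ := exists_lt_of_lt_real_iSup hr
    (lt_of_lt_real_iInf hr hP ⟨decisionLaw alg fun _ => P, this⟩)
  simp only [ProbabilityMeasure.coe_mk] at hlt
  set μP := historyLaw alg (fun _ => P) T le_rfl with hμP
  set μQ := historyLaw alg (fun _ => Q) T le_rfl with hμQ
  set d : D → ℝ := fun π => hellingerSq (P.kernel π) (Q.kernel π) with hd
  have hd0 : ∀ π, 0 ≤ d π := fun π => hellingerSq_nonneg _ _
  set E := ∫ π, d π ∂decisionLaw alg (fun _ => P) with hE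
  have hE0 : 0 ≤ E := integral_nonneg hd0
  have hEB : E = (T : ℝ)⁻¹ * ∫ h, cum alg (fun _ => d) T le_rfl h ∂μP :=
    integral_decisionLaw alg _ d
  set y := ∫ h, avgGap alg Q h ∂μP with hy
  have hy' : y = ∫ π, Q.gap π ∂decisionLaw alg (fun _ => P) := by
    rw [integral_decisionLaw, hy]
    exact integral_const_mul _ _
  have h1 : r + γ * E ≤ y := by
    have e : ∫ π, (Q.opt - Q.mean π - γ * hellingerSq (Q.kernel π) (P.kernel π))
        ∂decisionLaw alg (fun _ => P) = y - γ * E := by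
      rw [hy', hE, ← integral_const_mul, ← integral_sub (integrable_of_finite _ _)
        (integrable_of_finite _ _)]
      simp only [Model.gap, hd]
      congr 1
      ext π
      rw [hellingerSq_comm]
    rw [e] at hlt
    linarith
  have hX := measurable_avgGap alg Q
  have hX0 := avgGap_nonneg alg Q
  have hX1 := avgGap_le_one alg Q
  have hXabs : ∀ h, |avgGap alg Q h| ≤ 1 := fun h => by rw [abs_of_nonneg (hX0 h)]; exact hX1 h
  have hYabs : ∀ h, |avgGap alg P h| ≤ 1 := fun h => by
    rw [abs_of_nonneg (avgGap_nonneg alg P h)]; exact avgGap_le_one alg P h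
  set S := ∫ h, avgGap alg Q h ^ 2 ∂μP with hS
  set U := ∫ h, avgGap alg Q h ^ 2 ∂μQ with hU
  set R := ∫ h, avgGap alg P h ^ 2 ∂μP with hR
  have hS0 : 0 ≤ S := integral_nonneg fun _ => sq_nonneg _
  have hU0 : 0 ≤ U := integral_nonneg fun _ => sq_nonneg _
  have hmean : ∀ μ : Measure (Fin T → Round D O), IsProbabilityMeasure μ →
      ∫ h, avgGap alg Q h ∂μ ≤ √(∫ h, avgGap alg Q h ^ 2 ∂μ) := fun μ _ => by
    have := abs_integral_mul_le (μ := μ) hX (measurable_const (a := (1 : ℝ))) hXabs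
      (fun _ => by simp)
    simpa using (le_abs_self _).trans this
  let F : (Fin T → Round D O) → ℝ := fun h => (T : ℝ)⁻¹ * cum alg (fun _ π => √(d π)) T le_rfl h
  have hFm : Measurable F := (measurable_cum alg _ T le_rfl).const_mul _
  obtain ⟨K, hK⟩ := exists_abs_le fun (_ : Fin T) π => √(d π)
  have hFK : ∀ h, |F h| ≤ K := fun h => by
    rw [abs_mul, abs_of_nonneg (inv_nonneg.mpr hT0.le), inv_mul_le_iff₀ hT0]
    exact abs_cum_le alg hK T le_rfl h
  have hFE : ∫ h, F h ^ 2 ∂μP ≤ E := by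
    obtain ⟨K', hK'⟩ := exists_abs_le fun (_ : Fin T) => d
    rw [hEB, ← integral_const_mul]
    refine integral_mono_of_nonneg (ae_of_all _ fun _ => sq_nonneg _)
      ((integrable_of_abs_le (measurable_cum alg _ T le_rfl)
        (abs_cum_le alg hK' T le_rfl)).const_mul _) (ae_of_all _ fun h => ?_)
    have := sq_cum_le alg (fun _ π => √(d π)) T le_rfl h
    simp only [Real.sq_sqrt (hd0 _)] at this
    show ((T : ℝ)⁻¹ * cum alg (fun _ π => √(d π)) T le_rfl h) ^ 2 ≤
      (T : ℝ)⁻¹ * cum alg (fun _ => d) T le_rfl h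
    rw [mul_pow, sq (T : ℝ)⁻¹, mul_assoc]
    refine mul_le_mul_of_nonneg_left ?_ (by positivity)
    rwa [inv_mul_le_iff₀ hT0]
  -- Localization compares the optima up to `ε`; the Hellinger bound on means compares the rewards
  -- of the decisions.
  have hpt : ∀ h, avgGap alg Q h ≤ avgGap alg P h + ε + 2 * F h := by
    intro h
    have hg : ∀ (_ : Fin T) π, Q.gap π ≤ P.gap π + ε + 2 * √(d π) := fun _ π => by
      have := integral_sub_integral_le (P.kernel π) (Q.kernel π) measurable_reward abs_reward_le
      have h2 : P.mean π - Q.mean π ≤ 2 * √(d π) := this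
      unfold Model.gap
      linarith
    have := cum_mono alg (ψ := fun _ π => P.gap π + ε + 2 * √(d π)) hg T le_rfl h
    rw [cum_add, cum_add alg (fun _ => P.gap), cum_const, cum_const_mul] at this
    have := mul_le_mul_of_nonneg_left this (inv_nonneg.mpr hT0.le)
    refine this.trans (le_of_eq ?_)
    simp only [avgGap, F]
    field_simp
  -- Multiply `hpt` by the gap of `Q` and apply Cauchy-Schwarz. Keeping `ε * y`, with the first
  -- moment, is what lets the small radius be absorbed later.
  have h3 : S ≤ √S * (√R + 2 * √E) + ε * y := by
    set L := max 1 K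
    have b1 : ∀ h, |avgGap alg Q h| ≤ L := fun h => (hXabs h).trans (le_max_left _ _)
    have b2 : ∀ h, |avgGap alg P h| ≤ L := fun h => (hYabs h).trans (le_max_left _ _)
    have b3 : ∀ h, |F h| ≤ L := fun h => (hFK h).trans (le_max_right _ _)
    have c1 := (le_abs_self _).trans
      (abs_integral_mul_le (μ := μP) hX (measurable_avgGap alg P) b1 b2)
    have c2 := (le_abs_self _).trans (abs_integral_mul_le (μ := μP) hX hFm b1 b3)
    have hmul : ∀ {u v : (Fin T → Round D O) → ℝ}, Measurable u → Measurable v →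
        (∀ h, |u h| ≤ L) → (∀ h, |v h| ≤ L) → Integrable (fun h => u h * v h) μP :=
      fun hu hv h1 h2 => integrable_of_abs_le (hu.mul hv) (C := L * L) fun z => by
        rw [abs_mul]
        exact mul_le_mul (h1 z) (h2 z) (abs_nonneg _) ((abs_nonneg _).trans (h1 z))
    have i1 := hmul hX (measurable_avgGap alg P) b1 b2
    have i2 := hmul hX hFm b1 b3
    have i3 : Integrable (avgGap alg Q) μP := integrable_of_abs_le hX b1
    have i4 : Integrable (fun h => avgGap alg Q h * avgGap alg P h + ε * avgGap alg Q h) μP :=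
      i1.add (i3.const_mul _)
    have : S ≤ ∫ h, (avgGap alg Q h * avgGap alg P h + ε * avgGap alg Q h +
        2 * (avgGap alg Q h * F h)) ∂μP := by
      refine integral_mono_of_nonneg (ae_of_all _ fun _ => sq_nonneg _)
        (i4.add (i2.const_mul 2)) (ae_of_all _ fun h => ?_)
      have := mul_le_mul_of_nonneg_left (hpt h) (hX0 h)
      show avgGap alg Q h ^ 2 ≤ avgGap alg Q h * avgGap alg P h + ε * avgGap alg Q h +
        2 * (avgGap alg Q h * F h)
      nlinarith
    rw [integral_add i4 (i2.const_mul 2), integral_add i1 (i3.const_mul _), integral_const_mul,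
      integral_const_mul] at this
    have c3 := c2.trans (mul_le_mul_of_nonneg_left (Real.sqrt_le_sqrt hFE) (Real.sqrt_nonneg _))
    linarith
  have h4 := integral_historyLaw_le alg P Q hX hX0 hX1 (β := 2 * (T * E)) (by
    rw [hEB, mul_inv_cancel_left₀ hT0.ne'])
  have h2 : y ≤ √S := hmean μP inferInstance
  have hyQ := hmean μQ inferInstance
  have hs2 : √2 ≤ 3 / 2 := (Real.sqrt_le_left (by norm_num)).mpr (by norm_num)
  have hs2' : ∀ x, 0 ≤ x → √(2 * x) ≤ 3 / 2 * √x := fun x _ => by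
    rw [Real.sqrt_mul zero_le_two]
    exact mul_le_mul_of_nonneg_right hs2 (Real.sqrt_nonneg _)
  have h5 : √(2 * (S + U)) ≤ 3 / 2 * (√S + √U) := by
    refine (hs2' _ (add_nonneg hS0 hU0)).trans (mul_le_mul_of_nonneg_left ?_ (by norm_num))
    refine (Real.sqrt_le_left (by positivity)).mpr ?_
    nlinarith [Real.sq_sqrt hS0, Real.sq_sqrt hU0, mul_nonneg (Real.sqrt_nonneg S) (Real.sqrt_nonneg U)]
  have h6 : √(2 * (T * E)) ≤ 3 / 2 * (√T * √E) := by
    rw [← Real.sqrt_mul hT0.le]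
    exact hs2' _ (mul_nonneg hT0.le hE0)
  have hγ0 : 0 < γ := (Real.sqrt_nonneg _).trans_lt hγ
  have main : r ≤ 5 * √U + 5 * √R := by
    refine lower_bound_arith (τ := √T) (δ := √E) (y := y) (s := √S) (γ := γ) (ε := ε) (C := C)
      (Real.sqrt_pos.mpr hT0) (Real.sqrt_nonneg _) hr (Real.sqrt_nonneg _) (Real.sqrt_nonneg _)
      hC ?_ hγ0 ?_ ?_ h2 ?_ ?_
    · rw [Real.sq_sqrt hT0.le]
      exact (Real.sqrt_le_left hγ0.le).mp hγ.le
    · rw [Real.sq_sqrt hT0.le, hε]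
    · rwa [Real.sq_sqrt hE0]
    · rwa [Real.sq_sqrt hS0]
    · have h7 : √(2 * (T * E)) * (√S + √(2 * (S + U))) ≤
          3 / 2 * (√T * √E) * (√S + 3 / 2 * (√S + √U)) :=
        mul_le_mul h6 (by linarith) (by positivity) (by positivity)
      have h8 : y ≤ _ := h4
      refine h8.trans ((add_le_add hyQ h7).trans (le_of_eq ?_))
      ring
  rcases le_total (√U) (√R) with hle | hle
  · exact ⟨P, hPN, by linarith⟩
  · exact ⟨Q, hQN, by linarith⟩

end DecisionLaw

lemma abs_sq_le_sq {x C : ℝ} (h : |x| ≤ C) : |x ^ 2| ≤ C ^ 2 := by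
  rw [abs_pow]
  exact pow_le_pow_left₀ (abs_nonneg _) h 2

/-! ### Resampling one coordinate of an i.i.d. sequence. -/

section Resample

variable {T n : ℕ}

/-- Redrawing one coordinate of an i.i.d. sequence does not change its law. -/
lemma measurePreserving_update (μ : Measure (Fin n)) [IsProbabilityMeasure μ] (t : Fin T) :
    MeasurePreserving (fun x : (Fin T → Fin n) × Fin n => Function.update x.1 t x.2)
      ((Measure.pi fun _ => μ).prod μ) (Measure.pi fun _ => μ) := by
  refine ⟨Measurable.of_discrete, ?_⟩
  symm
  refine Measure.pi_eq fun S hS => ?_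
  rw [Measure.map_apply Measurable.of_discrete (MeasurableSet.univ_pi hS)]
  have : (fun x : (Fin T → Fin n) × Fin n => Function.update x.1 t x.2) ⁻¹' Set.univ.pi S =
      (Set.univ.pi (Function.update S t Set.univ)) ×ˢ S t := by
    ext ⟨s, i⟩
    simp only [Set.mem_preimage, Set.mem_pi, Set.mem_univ, true_imp_iff, Set.mem_prod]
    constructor
    · intro h
      refine ⟨fun r => ?_, by simpa using h t⟩
      by_cases hr : r = t
      · subst hr; simp
      · simpa [hr] using h r
    · rintro ⟨h1, h2⟩ r
      by_cases hr : r = t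
      · subst hr; simpa using h2
      · simpa [hr] using h1 r
  rw [this, Measure.prod_prod, Measure.pi_pi,
    ← Finset.mul_prod_erase Finset.univ _ (Finset.mem_univ t),
    ← Finset.mul_prod_erase Finset.univ (fun i => μ (S i)) (Finset.mem_univ t), mul_comm]
  simp only [Function.update_self, measure_univ, one_mul]
  congr 1
  refine Finset.prod_congr rfl fun r hr => ?_
  rw [Function.update_of_ne (Finset.ne_of_mem_erase hr)]

/-- A fresh copy of coordinate `t` allows the model of round `t` to be averaged with the past
frozen. -/
lemma lintegral_resample (μ : Measure (Fin n)) [IsProbabilityMeasure μ] (t : Fin T)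
    (G : (Fin T → Fin n) → ℝ≥0∞) :
    ∫⁻ s, G s ∂(Measure.pi fun _ => μ) =
      ∫⁻ s, ∫⁻ i, G (Function.update s t i) ∂μ ∂(Measure.pi fun _ => μ) := by
  rw [← (measurePreserving_update μ t).lintegral_comp Measurable.of_discrete,
    lintegral_prod _ Measurable.of_discrete.aemeasurable]

lemma integral_resample (μ : Measure (Fin n)) [IsProbabilityMeasure μ] (t : Fin T)
    (G : (Fin T → Fin n) → ℝ) :
    ∫ s, G s ∂(Measure.pi fun _ => μ) =
      ∫ s, ∫ i, G (Function.update s t i) ∂μ ∂(Measure.pi fun _ => μ) := by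
  conv_lhs => rw [← (measurePreserving_update μ t).map_eq]
  rw [integral_map Measurable.of_discrete.aemeasurable
    Measurable.of_discrete.aestronglyMeasurable, integral_prod _ Integrable.of_finite]

end Resample

/-! ### I.i.d. models against their mixture: history law and fluctuations. -/

section Mixture

variable {D O : Type*} [MeasurableSpace D] [MeasurableSpace O] {T n : ℕ}

/-- Models from round `t` on have not acted yet; hence resampling the model of round `t` leaves the
past intact. -/
lemma historyLaw_congr (alg : Algorithm T D O) {M M' : Fin T → Model D O} (t : ℕ) (ht : t ≤ T)
    (h : ∀ s : Fin T, (s : ℕ) < t → M s = M' s) : historyLaw alg M t ht = historyLaw alg M' t ht := by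
  induction t with
  | zero => rfl
  | succ t ih =>
    rw [historyLaw_succ, historyLaw_succ, ih _ fun s hs => h s (hs.trans t.lt_succ_self)]
    unfold roundKernel
    rw [h ⟨t, ht⟩ t.lt_succ_self]

/-- The law of the history when the models are indexed by the sequence `s`. -/
noncomputable abbrev indexedLaw (alg : Algorithm T D O) (m : Fin n → Model D O)
    (s : Fin T → Fin n) (t : ℕ) (ht : t ≤ T) : Measure (Fin t → Round D O) :=
  historyLaw alg (fun r => m (s r)) t ht

lemma indexedLaw_update (alg : Algorithm T D O) (m : Fin n → Model D O)
    (s : Fin T → Fin n) (t : ℕ) (ht : t < T) (i : Fin n) :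
    indexedLaw alg m (Function.update s ⟨t, ht⟩ i) t ht.le = indexedLaw alg m s t ht.le := by
  refine historyLaw_congr alg t ht.le fun r hr => ?_
  rw [Function.update_of_ne]
  exact fun h => by simp [h] at hr

lemma cum_indexed_update (alg : Algorithm T D O) (ψ : Fin n → D → ℝ) (s : Fin T → Fin n) (t : ℕ)
    (ht : t < T) (i : Fin n) :
    cum alg (fun r => ψ (Function.update s ⟨t, ht⟩ i r)) t ht.le =
      cum alg (fun r => ψ (s r)) t ht.le := by
  ext h
  refine Finset.sum_congr rfl fun r _ => ?_
  have : Function.update s ⟨t, ht⟩ i (r.castLE ht.le) = s (r.castLE ht.le) :=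
    Function.update_of_ne (fun h => by
      have := congrArg Fin.val h
      simp at this
      exact r.2.ne this) _ _
  simp only [this]

variable [Finite D] [MeasurableSingletonClass D]

/-- Playing against an i.i.d. sequence of models is the same, for the law of the history, as
playing against their mixture. -/
lemma lintegral_indexedLaw (alg : Algorithm T D O) (m : Fin n → Model D O) (M : Model D O)
    (μ : Measure (Fin n)) [IsProbabilityMeasure μ]
    (hM : ∀ π (f : Feedback O → ℝ≥0∞), Measurable f →
      ∫⁻ z, f z ∂M.kernel π = ∫⁻ i, ∫⁻ z, f z ∂(m i).kernel π ∂μ)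
    (t : ℕ) (ht : t ≤ T) {f : (Fin t → Round D O) → ℝ≥0∞} (hf : Measurable f) :
    ∫⁻ s, ∫⁻ h, f h ∂indexedLaw alg m s t ht ∂(Measure.pi fun _ => μ) =
      ∫⁻ h, f h ∂historyLaw alg (fun _ => M) t ht := by
  induction t with
  | zero => simp [indexedLaw, historyLaw]
  | succ t ih =>
    have hfs : Measurable fun q : (Fin t → Round D O) × Round D O =>
      f (Fin.snoc (α := fun _ => Round D O) q.1 q.2) := hf.comp (measurable_snoc t)
    have hmeas : ∀ K : Model D O, Measurable fun h : Fin t → Round D O =>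
        ∫⁻ π, ∫⁻ z, f (Fin.snoc (α := fun _ => Round D O) h (π, z)) ∂K.kernel π
          ∂alg.kernel t ht h := by
      intro K
      have e : ∀ h : Fin t → Round D O, ∫⁻ π, ∫⁻ z,
          f (Fin.snoc (α := fun _ => Round D O) h (π, z)) ∂K.kernel π ∂alg.kernel t ht h =
          ∫⁻ x, f (Fin.snoc (α := fun _ => Round D O) h x)
            ∂roundKernel alg (fun _ => K) t ht h := by
        intro h
        have hfh : Measurable fun x : Round D O =>
            f (Fin.snoc (α := fun _ => Round D O) h x) := hfs.comp measurable_prodMk_left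
        rw [lintegral_roundKernel _ _ _ _ _ hfh]
      simp_rw [e]
      exact hfs.lintegral_kernel_prod_right'
    simp_rw [indexedLaw, lintegral_historyLaw_succ _ _ _ _ hf]
    -- With the past law independent of the resampled index, averaging over that index inside the
    -- integrals replaces `m i` by `M`.
    rw [lintegral_resample μ ⟨t, ht⟩, ← ih (Nat.le_of_succ_le ht) (hmeas M)]
    refine lintegral_congr fun s => ?_
    have hu : ∀ i, historyLaw alg (fun r => m (Function.update s ⟨t, ht⟩ i r)) t
        (Nat.le_of_succ_le ht) = historyLaw alg (fun r => m (s r)) t (Nat.le_of_succ_le ht) :=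
      fun i => indexedLaw_update alg m s t ht i
    simp_rw [hu, Function.update_self]
    rw [lintegral_lintegral_swap]
    · refine lintegral_congr fun h => ?_
      rw [lintegral_lintegral_swap (Measurable.of_discrete).aemeasurable]
      refine lintegral_congr fun π => ?_
      exact (hM π _ (hfs.comp (measurable_const.prodMk
        (measurable_const.prodMk measurable_id)))).symm
    · exact (measurable_from_prod_countable_right fun i => hmeas (m i)).aemeasurable

/-- Increments that are centered for each fixed decision are orthogonal to the past. -/
lemma integral_indexedLaw_mul_eq_zero (alg : Algorithm T D O) (m : Fin n → Model D O)
    (μ : Measure (Fin n)) [IsProbabilityMeasure μ] {ψ : Fin n → D → ℝ}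
    (hψ : ∀ π, ∫ i, ψ i π ∂μ = 0) (t : ℕ) (ht : t < T)
    {Y : (Fin T → Fin n) → (Fin t → Round D O) → ℝ} (hY : ∀ s, Measurable (Y s)) {C : ℝ}
    (hYC : ∀ s h, |Y s h| ≤ C)
    (hYu : ∀ s i, Y (Function.update s ⟨t, ht⟩ i) = Y s) :
    ∫ s, ∫ h, Y s h * ∫ π, ψ (s ⟨t, ht⟩) π ∂alg.kernel t ht h ∂indexedLaw alg m s t ht.le
      ∂(Measure.pi fun _ => μ) = 0 := by
  obtain ⟨K, hK⟩ := exists_abs_le ψ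
  rw [integral_resample μ ⟨t, ht⟩]
  simp_rw [indexedLaw_update, hYu, Function.update_self]
  refine (integral_congr_ae (ae_of_all _ fun s => ?_)).trans (integral_zero _ _)
  have hm : Measurable fun x : Fin n × (Fin t → Round D O) =>
      Y s x.2 * ∫ π, ψ x.1 π ∂alg.kernel t ht x.2 :=
    measurable_from_prod_countable_right fun i => (hY s).mul
      ((Measurable.of_discrete (f := ψ i)).stronglyMeasurable.integral_kernel
        (κ := alg.kernel t ht)).measurable
  show ∫ i, ∫ h, Y s h * ∫ π, ψ i π ∂alg.kernel t ht h ∂indexedLaw alg m s t ht.le ∂μ = 0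
  -- The decision kernel depends on the history only, so the index is averaged first, at a fixed
  -- decision, where `ψ` is centered.
  rw [integral_integral_swap]
  · refine (integral_congr_ae (ae_of_all _ fun h => ?_)).trans (integral_zero _ _)
    show ∫ i, Y s h * ∫ π, ψ i π ∂alg.kernel t ht h ∂μ = 0
    rw [integral_const_mul, integral_integral_swap Integrable.of_finite]
    simp [hψ]
  · refine integrable_of_abs_le hm (C := C * K) fun x => ?_
    rw [Function.uncurry, abs_mul]
    exact mul_le_mul (hYC s x.2) (abs_integral_le (hK x.1)) (abs_nonneg _)
      ((abs_nonneg _).trans (hYC s x.2))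

/-- First and second moments of the sum of centered increments. -/
lemma integral_indexedLaw_cum (alg : Algorithm T D O) (m : Fin n → Model D O)
    (μ : Measure (Fin n)) [IsProbabilityMeasure μ] {ψ : Fin n → D → ℝ} {K : ℝ}
    (hψ : ∀ π, ∫ i, ψ i π ∂μ = 0) (hK : ∀ i π, |ψ i π| ≤ K) (t : ℕ) (ht : t ≤ T) :
    (∫ s, ∫ h, cum alg (fun r => ψ (s r)) t ht h ∂indexedLaw alg m s t ht
      ∂(Measure.pi fun _ => μ) = 0) ∧
    (∫ s, ∫ h, cum alg (fun r => ψ (s r)) t ht h ^ 2 ∂indexedLaw alg m s t ht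
      ∂(Measure.pi fun _ => μ) ≤ t * K ^ 2) := by
  induction t with
  | zero => simp [cum_zero]
  | succ t ih =>
    have ht' := Nat.le_of_succ_le ht
    obtain ⟨ih1, ih2⟩ := ih ht'
    have hNm : ∀ (t : ℕ) (ht : t ≤ T) (s : Fin T → Fin n), Measurable (cum alg (fun r => ψ (s r)) t ht) :=
      fun t ht s => measurable_cum alg _ t ht
    have hNK : ∀ (t : ℕ) (ht : t ≤ T) (s : Fin T → Fin n) h, |cum alg (fun r => ψ (s r)) t ht h| ≤ t * K :=
      fun t ht s => abs_cum_le alg (fun r π => hK (s r) π) t ht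
    have hdm : ∀ i, Measurable fun h => ∫ π, ψ i π ∂alg.kernel t ht h := fun i =>
      ((Measurable.of_discrete (f := ψ i)).stronglyMeasurable.integral_kernel
        (κ := alg.kernel t ht)).measurable
    have hdK : ∀ i h, |∫ π, ψ i π ∂alg.kernel t ht h| ≤ K := fun i h => abs_integral_le (hK i)
    have i1 : ∀ s, Integrable (cum alg (fun r => ψ (s r)) t ht') (indexedLaw alg m s t ht') :=
      fun s => integrable_of_abs_le (hNm t ht' s) (hNK t ht' s)
    have i2 : ∀ s, Integrable (fun h => ∫ π, ψ (s ⟨t, ht⟩) π ∂alg.kernel t ht h)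
        (indexedLaw alg m s t ht') := fun s => integrable_of_abs_le (hdm _) (hdK _)
    have i3 : ∀ s, Integrable (fun h => cum alg (fun r => ψ (s r)) t ht' h ^ 2)
        (indexedLaw alg m s t ht') :=
      fun s => integrable_of_abs_le ((hNm t ht' s).pow_const 2) fun h => abs_sq_le_sq (hNK t ht' s h)
    have i4 : ∀ s, Integrable (fun h => (∫ π, ψ (s ⟨t, ht⟩) π ∂alg.kernel t ht h) ^ 2)
        (indexedLaw alg m s t ht') := fun s =>
      integrable_of_abs_le ((hdm _).pow_const 2) fun h => abs_sq_le_sq (hdK _ h)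
    have i5 : ∀ s, Integrable (fun h => cum alg (fun r => ψ (s r)) t ht' h *
        ∫ π, ψ (s ⟨t, ht⟩) π ∂alg.kernel t ht h) (indexedLaw alg m s t ht') := fun s =>
      integrable_of_abs_le ((hNm t ht' s).mul (hdm _)) (C := t * K * K) fun h => by
        rw [abs_mul]
        exact mul_le_mul (hNK t ht' s h) (hdK _ h) (abs_nonneg _)
          ((abs_nonneg _).trans (hNK t ht' s h))
    have c1 := integral_indexedLaw_mul_eq_zero alg m μ hψ t ht (Y := fun _ _ => 1)
      (fun _ => measurable_const) (C := 1) (fun _ _ => by simp) (fun _ _ => rfl)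
    have c2 := integral_indexedLaw_mul_eq_zero alg m μ hψ t ht
      (Y := fun s => cum alg (fun r => ψ (s r)) t ht') (hNm t ht') (hNK t ht')
      (fun s i => cum_indexed_update alg ψ s t ht i)
    simp only [one_mul] at c1
    constructor
    · have e : ∀ s, ∫ h, cum alg (fun r => ψ (s r)) (t + 1) ht h ∂indexedLaw alg m s (t + 1) ht =
          ∫ h, cum alg (fun r => ψ (s r)) t ht' h ∂indexedLaw alg m s t ht' +
          ∫ h, ∫ π, ψ (s ⟨t, ht⟩) π ∂alg.kernel t ht h ∂indexedLaw alg m s t ht' :=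
        fun s => integral_cum_succ alg _ _ t ht
      simp_rw [e]
      rw [integral_add Integrable.of_finite Integrable.of_finite, ih1, c1, add_zero]
    -- The cross term vanishes by `c2`, so each round adds at most `K ^ 2` and the second moment
    -- grows linearly in `t`.
    · have e : ∀ s, ∫ h, cum alg (fun r => ψ (s r)) (t + 1) ht h ^ 2
            ∂indexedLaw alg m s (t + 1) ht =
          ∫ h, cum alg (fun r => ψ (s r)) t ht' h ^ 2 ∂indexedLaw alg m s t ht' +
          2 * ∫ h, cum alg (fun r => ψ (s r)) t ht' h *
            ∫ π, ψ (s ⟨t, ht⟩) π ∂alg.kernel t ht h ∂indexedLaw alg m s t ht' +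
          ∫ h, (∫ π, ψ (s ⟨t, ht⟩) π ∂alg.kernel t ht h) ^ 2 ∂indexedLaw alg m s t ht' := by
        intro s
        have i6 : Integrable (fun h => cum alg (fun r => ψ (s r)) t ht' h ^ 2 +
            2 * (cum alg (fun r => ψ (s r)) t ht' h *
              ∫ π, ψ (s ⟨t, ht⟩) π ∂alg.kernel t ht h)) (indexedLaw alg m s t ht') :=
          (i3 s).add ((i5 s).const_mul 2)
        rw [integral_historyLaw_succ alg _ t ht ((hNm (t + 1) ht s).pow_const 2)
          (fun h => abs_sq_le_sq (hNK (t + 1) ht s h)), ← integral_const_mul,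
          ← integral_add (i3 s) ((i5 s).const_mul 2), ← integral_add i6 (i4 s)]
        congr 1
        ext h
        simp only [cum_succ]
        simp
        ring
      simp_rw [e]
      rw [integral_add Integrable.of_finite Integrable.of_finite,
        integral_add Integrable.of_finite Integrable.of_finite, integral_const_mul, c2]
      have : ∫ s, ∫ h, (∫ π, ψ (s ⟨t, ht⟩) π ∂alg.kernel t ht h) ^ 2 ∂indexedLaw alg m s t ht'
          ∂(Measure.pi fun _ => μ) ≤ K ^ 2 := by
        refine (integral_mono Integrable.of_finite (integrable_const (K ^ 2)) fun s => ?_).trans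
          (by simp)
        refine (integral_mono (i4 s) (integrable_const (K ^ 2)) fun h => ?_).trans (by simp)
        exact (le_abs_self _).trans (abs_sq_le_sq (hdK _ h))
      push_cast
      linarith

end Mixture

lemma abs_max_zero_le {x C : ℝ} (h : |x| ≤ C) : |max x 0| ≤ C := by
  rw [abs_of_nonneg (le_max_right _ _)]
  exact max_le ((le_abs_self _).trans h) ((abs_nonneg _).trans h)

/-! ### The i.i.d. adversary and the moments of its regret. -/

section Adversary

variable {D O : Type*} [MeasurableSpace D] [MeasurableSpace O] {T n : ℕ}

/-- The adversary that draws the models independently from the law `μ` on the indices. -/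
noncomputable def iidAdversary (T : ℕ) {𝓜 : Set (Model D O)} (m : Fin n → Model D O)
    (hm : ∀ i, m i ∈ 𝓜) (μ : Measure (Fin n)) [IsProbabilityMeasure μ] :
    ObliviousAdversary T 𝓜 where
  n := n
  model := m
  mem := hm
  law := Measure.pi fun _ => μ
  isProb := inferInstance

lemma iidAdversary_isIID {𝓜 : Set (Model D O)} (m : Fin n → Model D O)
    (hm : ∀ i, m i ∈ 𝓜) (μ : Measure (Fin n)) [hμ : IsProbabilityMeasure μ] :
    (iidAdversary T m hm μ).IsIID :=
  ⟨μ, hμ, rfl⟩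

lemma regret_eq (alg : Algorithm T D O) (M : Fin T → Model D O) (h : Fin T → Round D O) :
    regret alg M h =
      ⨆ πs, cum alg (fun t π => (M t).mean πs - (M t).mean π) T le_rfl h := rfl

/-- Reads the mixture weights as a sampling law on the indices, for the adversary to draw from. -/
lemma exists_mixture_of_mem_co {𝓜 : Set (Model D O)} {M : Model D O} (hM : M ∈ co 𝓜) :
    ∃ (n : ℕ) (m : Fin n → Model D O) (μ : Measure (Fin n)), (∀ i, m i ∈ 𝓜) ∧
      IsProbabilityMeasure μ ∧
      (∀ π (f : Feedback O → ℝ≥0∞), Measurable f →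
        ∫⁻ z, f z ∂M.kernel π = ∫⁻ i, ∫⁻ z, f z ∂(m i).kernel π ∂μ) ∧
      ∀ π, M.mean π = ∫ i, (m i).mean π ∂μ := by
  obtain ⟨n, w, m, hw, hm, hk⟩ := hM
  refine ⟨n, m, ∑ i, w i • Measure.dirac i, hm, ⟨?_⟩, fun π f hf => ?_, fun π => ?_⟩
  · simp only [Measure.finsetSum_apply, Measure.smul_apply, measure_univ]
    simp only [ENNReal.smul_def, smul_eq_mul, mul_one]
    exact_mod_cast hw
  · rw [hk π, lintegral_finsetSum_measure, lintegral_finsetSum_measure]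
    simp [lintegral_smul_measure]
  · rw [Model.mean, hk π, integral_finsetSum_measure, integral_finsetSum_measure]
    · simp [Model.mean]
    · exact fun i _ => Integrable.of_finite
    · exact fun i _ => (integrable_of_abs_le measurable_reward abs_reward_le).smul_measure_nnreal

lemma nonempty_co {𝓜 : Set (Model D O)} (h𝓜 : 𝓜.Nonempty) : (co 𝓜).Nonempty := by
  obtain ⟨M, hM⟩ := h𝓜
  exact ⟨M, 1, fun _ => 1, fun _ => M, by simp, fun _ => hM, by simp⟩

lemma abs_mean_sub_le (M : Model D O) (π π' : D) : |M.mean π - M.mean π'| ≤ 1 := by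
  rw [abs_le]
  have := M.mean_nonneg π
  have := M.mean_nonneg π'
  have := M.mean_le_one π
  have := M.mean_le_one π'
  constructor <;> linarith

variable [Finite D]

lemma cum_le_regret (alg : Algorithm T D O) (M : Fin T → Model D O) (h : Fin T → Round D O)
    (πs : D) :
    cum alg (fun t π => (M t).mean πs - (M t).mean π) T le_rfl h ≤ regret alg M h := by
  rw [regret_eq]
  exact le_ciSup (f := fun πs => cum alg (fun t π => (M t).mean πs - (M t).mean π) T le_rfl h)
    (Set.finite_range _).bddAbove πs

variable [MeasurableSingletonClass D]

lemma measurable_regret (alg : Algorithm T D O) (M : Fin T → Model D O) :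
    Measurable (regret alg M) := by
  simp_rw [funext (regret_eq alg M)]
  exact Measurable.iSup fun πs => measurable_cum alg _ T le_rfl

variable [Nonempty D]

lemma abs_regret_le (alg : Algorithm T D O) (M : Fin T → Model D O) (h : Fin T → Round D O) :
    |regret alg M h| ≤ T := by
  have hb : ∀ πs, |cum alg (fun t π => (M t).mean πs - (M t).mean π) T le_rfl h| ≤ T := fun πs => by
    simpa using abs_cum_le alg (fun t π => abs_mean_sub_le (M t) πs π) T le_rfl h
  rw [abs_le]
  constructor
  · obtain ⟨πs⟩ := ‹Nonempty D›
    exact (abs_le.mp (hb πs)).1.trans (cum_le_regret alg M h πs)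
  · rw [regret_eq]
    exact ciSup_le fun πs => (abs_le.mp (hb πs)).2

/-- Lower bounds on the first two moments of the regret for the adversary that draws its models
independently from a mixture equal to `M`. -/
theorem exists_iid_adversary (alg : Algorithm T D O) {𝓜 : Set (Model D O)} {M : Model D O}
    (hM : M ∈ co 𝓜) :
    ∃ adv : ObliviousAdversary T 𝓜, adv.IsIID ∧
      T * ∫ h, avgGap alg M h ∂historyLaw alg (fun _ => M) T le_rfl ≤
        adv.expectRegret alg (fun x => x) ∧
      T ^ 2 * ∫ h, avgGap alg M h ^ 2 ∂historyLaw alg (fun _ => M) T le_rfl ≤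
        2 * adv.expectRegret alg (fun x => max x 0 ^ 2) + 8 * T := by
  obtain ⟨n, m, μ, hm, hμ, hmix, hmean⟩ := exists_mixture_of_mem_co hM
  refine ⟨iidAdversary T m hm μ, iidAdversary_isIID m hm μ, ?_⟩
  obtain ⟨πs, hπs⟩ := M.exists_mean_eq_opt
  let κ : Kernel (Fin T → Fin n) (Fin T → Round D O) :=
    Kernel.ofFunOfCountable fun s => indexedLaw alg m s T le_rfl
  have hκ : IsMarkovKernel κ := ⟨fun s =>
    inferInstanceAs (IsProbabilityMeasure (indexedLaw alg m s T le_rfl))⟩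
  have hE : ∀ φ, (iidAdversary T m hm μ).expectRegret alg φ =
      ∫ ω, φ (regret alg (fun t => m (ω.1 t)) ω.2) ∂((Measure.pi fun _ => μ) ⊗ₘ κ) :=
    fun φ => rfl
  -- Deviation of the drawn model's regret against `πs` from the gap of the mixture; it is centered
  -- because the mean rewards of `M` are `μ`-averages.
  let ψ : Fin n → D → ℝ := fun i π =>
    ((m i).mean πs - (m i).mean π) - (M.mean πs - M.mean π)
  have hψ0 : ∀ π, ∫ i, ψ i π ∂μ = 0 := fun π => by
    simp only [ψ]
    rw [integral_sub Integrable.of_finite (integrable_const _),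
      integral_sub Integrable.of_finite Integrable.of_finite, ← hmean, ← hmean]
    simp
  have hψ2 : ∀ i π, |ψ i π| ≤ 2 := fun i π => by
    have h1 := abs_le.mp (abs_mean_sub_le (m i) πs π)
    have h2 := abs_le.mp (abs_mean_sub_le M πs π)
    rw [abs_le]
    constructor <;> simp only [ψ] <;> linarith [h1.1, h1.2, h2.1, h2.2]
  obtain ⟨hN1, hN2⟩ := integral_indexedLaw_cum alg m μ hψ0 hψ2 T le_rfl
  set ν := (Measure.pi fun _ : Fin T => μ) ⊗ₘ κ with hν
  let Reg : (Fin T → Fin n) × (Fin T → Round D O) → ℝ :=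
    fun ω => regret alg (fun t => m (ω.1 t)) ω.2
  let N : (Fin T → Fin n) × (Fin T → Round D O) → ℝ :=
    fun ω => cum alg (fun t => ψ (ω.1 t)) T le_rfl ω.2
  have hRegm : Measurable Reg :=
    measurable_from_prod_countable_right fun s => measurable_regret alg (fun t => m (s t))
  have hNm : Measurable N :=
    measurable_from_prod_countable_right fun s => measurable_cum alg (fun t => ψ (s t)) T le_rfl
  have hRegT : ∀ ω, |Reg ω| ≤ T := fun ω => abs_regret_le alg (fun t => m (ω.1 t)) ω.2
  have hNT : ∀ ω, |N ω| ≤ T * 2 := fun ω => abs_cum_le alg (fun t => hψ2 (ω.1 t)) T le_rfl ω.2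
  have hNsq : ∀ ω, |N ω ^ 2| ≤ (T * 2) ^ 2 := fun ω => abs_sq_le_sq (hNT ω)
  have hRegsq : ∀ ω, |max (Reg ω) 0 ^ 2| ≤ (T : ℝ) ^ 2 := fun ω =>
    abs_sq_le_sq (abs_max_zero_le (hRegT ω))
  have iReg : Integrable Reg ν := integrable_of_abs_le hRegm hRegT
  have iN : Integrable N ν := integrable_of_abs_le hNm hNT
  have iN2 : Integrable (fun ω => N ω ^ 2) ν := integrable_of_abs_le (hNm.pow_const 2) hNsq
  have iR2 : Integrable (fun ω => max (Reg ω) 0 ^ 2) ν :=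
    integrable_of_abs_le ((hRegm.max measurable_const).pow_const 2) hRegsq
  have eN : ∫ ω, N ω ∂ν = 0 := by
    rw [hν, Measure.integral_compProd iN]
    exact hN1
  have eN2 : ∫ ω, N ω ^ 2 ∂ν ≤ T * 2 ^ 2 := by
    rw [hν, Measure.integral_compProd iN2]
    exact hN2
  have hsnd : ν.map Prod.snd = historyLaw alg (fun _ => M) T le_rfl := by
    refine Measure.ext_of_lintegral _ fun f hf => ?_
    have hf' : Measurable fun ω : (Fin T → Fin n) × (Fin T → Round D O) => f ω.2 :=
      hf.comp measurable_snd
    rw [lintegral_map hf measurable_snd, hν, Measure.lintegral_compProd hf',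
      ← lintegral_indexedLaw alg m M μ hmix T le_rfl hf]
    rfl
  have hX : ∀ {X : (Fin T → Round D O) → ℝ}, Measurable X →
      ∫ h, X h ∂historyLaw alg (fun _ => M) T le_rfl = ∫ ω, X ω.2 ∂ν := fun hX => by
    rw [← hsnd, integral_map measurable_snd.aemeasurable hX.aestronglyMeasurable]
  -- The left side is exactly the regret against the fixed comparator `πs`, optimal for `M`.
  have hpt : ∀ ω, T * avgGap alg M ω.2 + N ω ≤ Reg ω := by
    intro ω
    refine le_trans (le_of_eq ?_) (cum_le_regret alg (fun t => m (ω.1 t)) ω.2 πs)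
    have e : T * avgGap alg M ω.2 = cum alg (fun _ => M.gap) T le_rfl ω.2 := by
      unfold avgGap
      rcases eq_or_ne (T : ℝ) 0 with h | h
      · have : T = 0 := by exact_mod_cast h
        subst this
        simp [cum_zero]
      · rw [mul_inv_cancel_left₀ h]
    rw [e, ← cum_add]
    congr 1
    ext t π
    simp only [ψ, Model.gap, hπs]
    ring
  have mX := measurable_avgGap alg M
  have hX1 : ∀ h, |avgGap alg M h| ≤ 1 := fun h => by
    rw [abs_of_nonneg (avgGap_nonneg alg M h)]; exact avgGap_le_one alg M h
  constructor
  · have iX : Integrable (fun ω : (Fin T → Fin n) × (Fin T → Round D O) => T * avgGap alg M ω.2) ν :=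
      (integrable_of_abs_le (C := 1) (mX.comp measurable_snd) fun _ => hX1 _).const_mul _
    have := integral_mono (iX.add iN) iReg hpt
    rw [hE, hX mX, ← integral_const_mul]
    rwa [integral_add' iX iN, eN, add_zero] at this
  · rw [hE, hX (mX.pow_const 2), ← integral_const_mul]
    have : ∫ ω, (T : ℝ) ^ 2 * avgGap alg M ω.2 ^ 2 ∂ν ≤
        ∫ ω, (2 * max (Reg ω) 0 ^ 2 + 2 * N ω ^ 2) ∂ν := by
      refine integral_mono_of_nonneg (ae_of_all _ fun ω => by positivity)
        ((iR2.const_mul 2).add (iN2.const_mul 2)) (ae_of_all _ fun ω => ?_)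
      show (T : ℝ) ^ 2 * avgGap alg M ω.2 ^ 2 ≤ 2 * max (Reg ω) 0 ^ 2 + 2 * N ω ^ 2
      -- Nonnegativity permits squaring, so only the positive part of the regret is charged.
      have h1 : 0 ≤ T * avgGap alg M ω.2 := mul_nonneg (by positivity) (avgGap_nonneg alg M _)
      have h2 : T * avgGap alg M ω.2 ≤ max (Reg ω) 0 - N ω := by
        linarith [hpt ω, le_max_left (Reg ω) 0]
      have h3 := pow_le_pow_left₀ h1 h2 2
      rw [mul_pow] at h3
      nlinarith [sq_nonneg (max (Reg ω) 0 + N ω)]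
    rw [integral_add (iR2.const_mul 2) (iN2.const_mul 2), integral_const_mul 2,
      integral_const_mul 2] at this
    refine this.trans ?_
    have h4 : 2 * ∫ ω, N ω ^ 2 ∂ν ≤ 8 * T := by linarith
    linarith

end Adversary

/-! ### The lower rate. -/

section Rate

variable {D O : Type*} [MeasurableSpace D] [MeasurableSpace O]

/-- `T ≥ 2` and `V ≥ e` give `log (T ∧ V) ≥ log 2 ≥ 1/2`. The minimum is finite even when `V = ∞`,
so `toReal` loses nothing. -/
lemma le_logFactor (𝓜 : Set (Model D O)) {T : ℕ} (hT : 2 ≤ T) {c : ℝ} (hc : 256 ≤ c) :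
    128 ≤ logFactor c T 𝓜 := by
  have h2 : (2 : ℝ≥0∞) ≤ min (T : ℝ≥0∞) (densityRatio 𝓜) := by
    refine le_min (by exact_mod_cast hT) (le_trans ?_ le_sup_right)
    rw [show (2 : ℝ≥0∞) = ENNReal.ofReal 2 by simp]
    exact ENNReal.ofReal_le_ofReal (by linarith [Real.add_one_le_exp (1 : ℝ)])
  have h3 : (2 : ℝ) ≤ (min (T : ℝ≥0∞) (densityRatio 𝓜)).toReal := by
    have := ENNReal.toReal_mono
      (ne_top_of_le_ne_top (ENNReal.natCast_ne_top T) (min_le_left _ _)) h2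
    simpa using this
  have h4 : 1 / 2 ≤ Real.log (min (T : ℝ≥0∞) (densityRatio 𝓜)).toReal := by
    refine le_trans ?_ (Real.log_le_log two_pos h3)
    linarith [Real.log_two_gt_d9]
  unfold logFactor
  nlinarith

/-- For every algorithm, some mixture of models makes the second moment of the average gap at least
of the order of the lower rate. -/
lemma exists_lowerRate_le [Finite D] [MeasurableSingletonClass D] [Nonempty D]
    {𝓜 : Set (Model D O)} (h𝓜 : 𝓜.Nonempty) {T : ℕ} (hT : 2 ≤ T) {c : ℝ} (hc : 256 ≤ c)
    (alg : Algorithm T D O) :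
    ∃ M ∈ co 𝓜, lowerRate c T 𝓜 ≤
      20 * √(∫ h, avgGap alg M h ^ 2 ∂historyLaw alg (fun _ => M) T le_rfl) := by
  rcases le_or_gt (lowerRate c T 𝓜) 0 with h0 | h0
  · obtain ⟨M, hM⟩ := nonempty_co h𝓜
    exact ⟨M, hM, h0.trans (by positivity)⟩
  -- The supremum need not be attained, so half of it is targeted; this doubles the constant 10.
  · obtain ⟨⟨γ, hγ⟩, h⟩ := exists_lt_of_lt_real_iSup (half_pos h0).le (half_lt_self h0)
    obtain ⟨M, hM, hr⟩ := exists_le_sqrt_integral_avgGap_sq alg (by omega) (co 𝓜)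
      (le_logFactor 𝓜 hT hc) hγ rfl (half_pos h0).le h
    exact ⟨M, hM, by linarith⟩

end Rate

end DMSO

theorem mainTheorem2 :
    ∃ c₀ a b : ℝ, 0 < c₀ ∧ 0 < a ∧ 0 < b ∧
      ∀ (D O : Type*) [Finite D] [Nonempty D] [MeasurableSpace D] [MeasurableSingletonClass D]
        [MeasurableSpace O] (𝓜 : Set (DMSO.Model D O)) (_ : 𝓜.Nonempty)
        (T : ℕ) (_ : 2 ≤ T) (c : ℝ) (_ : c₀ ≤ c) (alg : DMSO.Algorithm T D O),
        (∃ adv : DMSO.ObliviousAdversary T 𝓜, adv.IsIID ∧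
          adv.expectRegret alg (fun x => x) + √(adv.expectRegret alg (fun x => (max x 0) ^ 2))
            ≥ a * DMSO.lowerRate c T 𝓜 * T - b * √(T : ℝ)) ∧
        (∃ adv : DMSO.ObliviousAdversary T 𝓜, adv.IsIID ∧
          0 ≤ adv.expectRegret alg (fun x => x) ∧
          adv.expectRegret alg (fun x => x) + √(adv.expectRegret alg (fun x => x) * T)
            ≥ a * DMSO.lowerRate c T 𝓜 * T) := by
  -- The rate times `T` is at most `20 T √U ≤ 20 (2 √E₂ + 4 √T)`; dividing by 40 gives `a = 1/40`
  -- and `b = 2`.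
  refine ⟨256, 1 / 40, 2, by norm_num, by norm_num, by norm_num, ?_⟩
  intro D O _ _ _ _ _ 𝓜 h𝓜 T hT c hc alg
  obtain ⟨M, hM, hL⟩ := DMSO.exists_lowerRate_le h𝓜 hT hc alg
  obtain ⟨adv, hiid, h1, h2⟩ := DMSO.exists_iid_adversary alg hM
  set X := ∫ h, DMSO.avgGap alg M h ∂DMSO.historyLaw alg (fun _ => M) T le_rfl
  set U := ∫ h, DMSO.avgGap alg M h ^ 2 ∂DMSO.historyLaw alg (fun _ => M) T le_rfl
  set E := adv.expectRegret alg (fun x => x)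
  set E₂ := adv.expectRegret alg (fun x => max x 0 ^ 2)
  have hT0 : (0 : ℝ) ≤ T := Nat.cast_nonneg T
  have hX0 : 0 ≤ X := integral_nonneg fun h => DMSO.avgGap_nonneg alg M h
  have hU0 : 0 ≤ U := integral_nonneg fun h => sq_nonneg _
  have hE0 : 0 ≤ E := le_trans (mul_nonneg hT0 hX0) h1
  have hE₂ : 0 ≤ E₂ := integral_nonneg fun ω => sq_nonneg _
  have hUX : U ≤ X := by
    refine integral_mono_of_nonneg (ae_of_all _ fun _ => sq_nonneg _)
      (DMSO.integrable_of_abs_le (DMSO.measurable_avgGap alg M) (C := 1) fun h => ?_)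
      (ae_of_all _ fun h => ?_)
    · rw [abs_of_nonneg (DMSO.avgGap_nonneg alg M h)]
      exact DMSO.avgGap_le_one alg M h
    · exact pow_le_of_le_one (DMSO.avgGap_nonneg alg M h) (DMSO.avgGap_le_one alg M h) two_ne_zero
  have hLT := mul_le_mul_of_nonneg_right hL hT0
  have hu0 := Real.sqrt_nonneg U
  have hTu : T * √U = √(T ^ 2 * U) := by rw [Real.sqrt_mul (sq_nonneg _), Real.sqrt_sq hT0]
  refine ⟨⟨adv, hiid, ?_⟩, ⟨adv, hiid, hE0, ?_⟩⟩
  · have h3 : T * √U ≤ 2 * √E₂ + 4 * √T := by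
      rw [hTu]
      refine (Real.sqrt_le_left (by positivity)).mpr (h2.trans ?_)
      nlinarith [Real.sq_sqrt hE₂, Real.sq_sqrt hT0,
        mul_nonneg (Real.sqrt_nonneg E₂) (Real.sqrt_nonneg (T : ℝ))]
    linarith
  -- `T² U ≤ T · (T X) ≤ T E`, by `hUX` and `h1`.
  · have h3 : T * √U ≤ √(E * T) := by
      rw [hTu]
      refine Real.sqrt_le_sqrt ?_
      nlinarith [mul_le_mul_of_nonneg_left hUX hT0]
    have : 0 ≤ T * √U := mul_nonneg hT0 hu0
    linarith
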